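/- **Generalized Hamilton–Jacobi equation.** Let $n\ge 2$, $N\ge 1$, let $\Phi=(\Phi_1,\dots,\Phi_f)$ be smooth fields on $\mathbb R^n$ with values in $\mathbb R$ (or $\mathbb C$), and let $L=L(x,\Phi,\partial\Phi,\dots,\partial^N\Phi)$ be a Lagrangian that is smooth in all its arguments on an open set of arguments (complex differentiable in the field variables in the complex case) and depends only on the symmetrized derivatives; all $\partial_{\lambda_1}\cdots\partial_{\lambda_X}\Phi_B$ are treated as independent arguments when $L$ is differentiated. For a bounded open set $\Omega\subset\mathbb R^n$ put $A_\Omega[\Phi]=\int_\Omega L(x,\Phi(x),\dots,\partial^N\Phi(x))\,d^nx$. A *real movement* over $\Omega$ is a smooth $\Phi$, with arguments in the domain of $L$ over $\overline\Omega$, at which $A_\Omega$ is stationary under all smooth variations $\delta\Phi$ with $\delta\Phi=\dots=\partial^{N-1}\delta\Phi=0$ on $\partial\Omega$. Define (summation over repeated coordinate indices) $$K^{B\lambda\nu_1\dots\nu_Z}=\sum_{Y=0}^{N-1-Z}(-1)^Y\partial_{\mu_1}\cdots\partial_{\mu_Y}\frac{\partial L}{\partial(\partial_\lambda\partial_{\mu_1}\cdots\partial_{\mu_Y}\partial_{\nu_1}\cdots\partial_{\nu_Z}\Phi_B)},\qquad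 \tau^\lambda_\sigma=\delta^\lambda_\sigma L-\sum_{B=1}^f\sum_{Z=0}^{N-1}\partial_\sigma\partial_{\nu_1}\cdots\partial_{\nu_Z}\Phi_B\,K^{B\lambda\nu_1\dots\nu_Z}.$$ Let $\mathcal F$ be a class of pairs ($\Omega',\Phi'$), with $\Phi'$ a real movement over $\Omega'$, and let $S$ be Hamilton's principal functional on $\mathcal F$: a functional of a hypersurface and of boundary data on it with $S[\partial\Omega',\Phi'|_{\partial\Omega'},\dots,\partial^{N-1}\Phi'|_{\partial\Omega'}]=A_{\Omega'}[\Phi']$ for all $(\Omega',\Phi')\in\mathcal F$. Let $(\Omega,\Phi)\in\mathcal F$, where $\Omega$ is bounded and open and $\Sigma=\partial\Omega$ is a smooth hypersurface with $\Omega$ locally on one side, and let $ds_\lambda$ be its outward surface element. Continuous functions $Y^\lambda_\sigma$, $Z^{B\lambda\nu_1\dots\nu_Z}$ on $\Sigma$ are called functional derivatives $\left(\frac{\delta S}{\delta\Sigma^\sigma(x)}\right)^\lambda$, $\left(\frac{\delta S}{\delta\partial_{\nu_1}\cdots\partial_{\nu_Z}\Phi_B(x)}\right)^\lambda$ of $S$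 at $(\Sigma,\Phi)$ if $$\delta S=\int_\Sigma ds_\lambda\Big\{Y^\lambda_\sigma\,\delta\Sigma^\sigma+\sum_{B=1}^f\sum_{Z=0}^{N-1}Z^{B\lambda\nu_1\dots\nu_Z}\,\delta(\partial_{\nu_1}\cdots\partial_{\nu_Z}\Phi_B)\Big\}$$ for all smooth one-parameter families $(\psi_\varepsilon(\Omega),\Phi_\varepsilon)\in\mathcal F$ ($\varepsilon$ near $0$, $\psi_0=\mathrm{id}$, $\Phi_0=\Phi$), where $\delta=\frac{d}{d\varepsilon}\big|_{\varepsilon=0}$, $\delta\Sigma(x)=\delta[\psi_\varepsilon(x)]$, and $\delta(\partial_{\nu_1}\cdots\partial_{\nu_Z}\Phi_B)(x)=\delta[(\partial_{\nu_1}\cdots\partial_{\nu_Z}\Phi_{\varepsilon,B})(\psi_\varepsilon(x))]$. Then $S$ has the functional derivatives $$\left(\frac{\delta S}{\delta\Sigma^\sigma(x)}\right)^\lambda-\tau^\lambda_\sigma(x)=0,\qquad \left(\frac{\delta S}{\delta\partial_{\nu_1}\cdots\partial_{\nu_Z}\Phi_B(x)}\right)^\lambda=K^{B\lambda\nu_1\dots\nu_Z}(x)\quad(0\le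 Z\le N-1,\ 1\le B\le f).$$ Moreover, if for every smooth deformation $\psi_\varepsilon$ with $\psi_0=\mathrm{id}$ the pair $(\psi_\varepsilon(\Omega),\Phi)$ belongs to $\mathcal F$ for all small $\varepsilon$, then the first equation determines the derivative with respect to the hypersurface, as far as it enters $\delta S$: any functional derivatives $(Y,K)$ satisfy $ds_\lambda\,(Y^\lambda_\sigma-\tau^\lambda_\sigma)=0$ on $\Sigma$ for every $\sigma$. -/

import Mathlib

open scoped ContDiff Topology
open MeasureTheory

noncomputable section

namespace HamiltonJacobi

/-! ### Partial derivatives and jets -/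

/-- The coordinate partial derivative `∂_i g` at `x`. -/
def pd {n : ℕ} {F : Type*} [NormedAddCommGroup F] [NormedSpace ℝ F]
    (i : Fin n) (g : (Fin n → ℝ) → F) (x : Fin n → ℝ) : F :=
  fderiv ℝ g x (Pi.single i 1)

/-- The iterated partial derivative `∂_{μ 0} ∂_{μ 1} ⋯ ∂_{μ (k-1)} g`. -/
def iterPD {n : ℕ} {F : Type*} [NormedAddCommGroup F] [NormedSpace ℝ F] :
    {k : ℕ} → (Fin k → Fin n) → ((Fin n → ℝ) → F) → (Fin n → ℝ) → F
  | 0, _, g => g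
  | _ + 1, μ, g => pd (μ 0) (iterPD (Fin.tail μ) g)

/-- Values of all the derivatives of order `< k` of `f` scalar fields on `ℝⁿ`: the entry
`u X μ B` stands for `∂_{μ 0} ⋯ ∂_{μ (X-1)} Φ_B`.  All index tuples occur, so that the mixed
derivatives with permuted indices are separate variables. -/
abbrev Jet (𝕜 : Type*) (n f k : ℕ) : Type _ :=
  (X : Fin k) → (Fin (X : ℕ) → Fin n) → Fin f → 𝕜

/-- The derivatives of order `< k` of the fields `Φ` at `x`. -/
def jet {𝕜 : Type*} [RCLike 𝕜] {n f : ℕ} (k : ℕ) (Φ : (Fin n → ℝ) → Fin f → 𝕜)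
    (x : Fin n → ℝ) : Jet 𝕜 n f k :=
  fun _ μ B => iterPD μ (fun y => Φ y B) x

/-- Symmetrisation in the derivative indices. -/
def symJet {𝕜 : Type*} [RCLike 𝕜] {n f k : ℕ} (u : Jet 𝕜 n f k) : Jet 𝕜 n f k :=
  fun X μ B => ((Nat.factorial (X : ℕ) : ℕ) : 𝕜)⁻¹ *
    ∑ P : Equiv.Perm (Fin (X : ℕ)), u X (fun j => μ (P j)) B

/-! ### Lagrangians, action, real movements -/

/-- `L` is a smooth Lagrangian of order `N`, defined on the open set `𝒰` of arguments
`(x, Φ, ∂Φ, …, ∂^N Φ)`, and written in the standard form in which it depends only on the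
symmetrised derivatives.  For complex fields smoothness in the field variables is meant in
the complex sense (a field and its conjugate count as two fields). -/
structure IsLagrangian {𝕜 : Type*} [RCLike 𝕜] {n f N : ℕ}
    (L : (Fin n → ℝ) × Jet 𝕜 n f (N + 1) → 𝕜)
    (𝒰 : Set ((Fin n → ℝ) × Jet 𝕜 n f (N + 1))) : Prop where
  isOpen : IsOpen 𝒰
  smooth : ContDiffOn ℝ ∞ L 𝒰
  differentiable : ∀ p ∈ 𝒰, DifferentiableAt 𝕜 (fun u => L (p.1, u)) p.2
  symm : ∀ p ∈ 𝒰, (p.1, symJet p.2) ∈ 𝒰 ∧ L (p.1, symJet p.2) = L p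

/-- `∂L / ∂(∂_{μ 0} ⋯ ∂_{μ (X-1)} Φ_B)`, all entries of the jet being treated as independent;
it is `0` if `X > N`. -/
def partialL {𝕜 : Type*} [RCLike 𝕜] {n f N : ℕ}
    (L : (Fin n → ℝ) × Jet 𝕜 n f (N + 1) → 𝕜) {X : ℕ} (μ : Fin X → Fin n) (B : Fin f)
    (p : (Fin n → ℝ) × Jet 𝕜 n f (N + 1)) : 𝕜 :=
  if h : X < N + 1 then
    fderiv 𝕜 (fun u => L (p.1, u)) p.2
      (Pi.single (⟨X, h⟩ : Fin (N + 1)) (Pi.single μ (Pi.single B 1)))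
  else 0

/-- The action `A[Φ] = ∫_Ω L(x, Φ, ∂Φ, …, ∂^N Φ) dⁿx`. -/
def action {𝕜 : Type*} [RCLike 𝕜] {n f N : ℕ}
    (L : (Fin n → ℝ) × Jet 𝕜 n f (N + 1) → 𝕜) (Ω : Set (Fin n → ℝ))
    (Φ : (Fin n → ℝ) → Fin f → 𝕜) : 𝕜 :=
  ∫ x in Ω, L (x, jet (N + 1) Φ x)

/-- `Φ` is a real movement over `Ω`: it makes the action over `Ω` stationary among the fields
with the same boundary values of `Φ, ∂Φ, …, ∂^{N-1}Φ`. -/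
structure IsRealMovement {𝕜 : Type*} [RCLike 𝕜] {n f N : ℕ}
    (L : (Fin n → ℝ) × Jet 𝕜 n f (N + 1) → 𝕜)
    (𝒰 : Set ((Fin n → ℝ) × Jet 𝕜 n f (N + 1)))
    (Ω : Set (Fin n → ℝ)) (Φ : (Fin n → ℝ) → Fin f → 𝕜) : Prop where
  smooth : ContDiff ℝ ∞ Φ
  mem : ∀ x ∈ closure Ω, (x, jet (N + 1) Φ x) ∈ 𝒰
  stationary : ∀ η : (Fin n → ℝ) → Fin f → 𝕜, ContDiff ℝ ∞ η →
    (∀ x ∈ frontier Ω, jet N η x = 0) →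
    HasDerivAt (fun ε : ℝ => action L Ω (fun x => Φ x + ε • η x)) 0 0

/-- The coefficients
`K^{B l ν} = ∑_{Y=0}^{N-1-Z} (-1)^Y ∂_{μ₁} ⋯ ∂_{μ_Y} ∂L/∂(∂_l ∂_{μ₁} ⋯ ∂_{μ_Y} ∂_{ν₁} ⋯ ∂_{ν_Z} Φ_B)`
(with summation over the indices `μ`), evaluated along `Φ`. -/
def momentumK {𝕜 : Type*} [RCLike 𝕜] {n f N : ℕ}
    (L : (Fin n → ℝ) × Jet 𝕜 n f (N + 1) → 𝕜) (Φ : (Fin n → ℝ) → Fin f → 𝕜)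
    (x : Fin n → ℝ) (l : Fin n) : Jet 𝕜 n f N :=
  fun Z ν B => ∑ Y ∈ Finset.range (N - (Z : ℕ)), (-1 : 𝕜) ^ Y *
    ∑ μ : Fin Y → Fin n,
      iterPD μ (fun y => partialL L (Fin.cons l (Fin.append μ ν) : Fin (Y + (Z : ℕ) + 1) → Fin n) B
        (y, jet (N + 1) Φ y)) x

/-- The canonical energy-momentum
`τ^l_σ = δ^l_σ L - ∑_B ∑_{Z<N} ∂_σ ∂_{ν₁} ⋯ ∂_{ν_Z} Φ_B K^{B l ν₁ … ν_Z}`. -/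
def energyMomentum {𝕜 : Type*} [RCLike 𝕜] {n f N : ℕ}
    (L : (Fin n → ℝ) × Jet 𝕜 n f (N + 1) → 𝕜) (Φ : (Fin n → ℝ) → Fin f → 𝕜)
    (x : Fin n → ℝ) (l σ : Fin n) : 𝕜 :=
  (if l = σ then L (x, jet (N + 1) Φ x) else 0) -
    ∑ Z : Fin N, ∑ ν : Fin (Z : ℕ) → Fin n, ∑ B : Fin f,
      pd σ (fun y => jet N Φ y Z ν B) x * momentumK L Φ x l Z ν B

/-! ### Closed hypersurfaces and their surface element -/

/-- A piece of the smooth boundary of `Ω`: inside the open set `W`, the set `Ω` is one side of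
the graph `x_i = g(the other coordinates)`. -/
structure GraphPatch (m : ℕ) (Ω : Set (Fin (m + 1) → ℝ)) where
  W : Set (Fin (m + 1) → ℝ)
  isOpen_W : IsOpen W
  i : Fin (m + 1)
  s : ℝ
  s_eq : s = 1 ∨ s = -1
  g : (Fin m → ℝ) → ℝ
  smooth_g : ContDiff ℝ ∞ g
  mem_iff : ∀ x ∈ W, (x ∈ Ω ↔ s * x i < s * g (i.removeNth x))

/-- The parametrisation `θ ↦ x(θ)` of the hypersurface in the patch. -/
def GraphPatch.point {m : ℕ} {Ω : Set (Fin (m + 1) → ℝ)} (P : GraphPatch m Ω)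
    (θ : Fin m → ℝ) : Fin (m + 1) → ℝ :=
  Fin.insertNth (α := fun _ => ℝ) P.i (P.g θ) θ

/-- The outward surface element: `ds_l = conormal θ l dθ`, that is, the gradient of
`s (x_i - g)`. -/
def GraphPatch.conormal {m : ℕ} {Ω : Set (Fin (m + 1) → ℝ)} (P : GraphPatch m Ω)
    (θ : Fin m → ℝ) : Fin (m + 1) → ℝ :=
  Fin.insertNth (α := fun _ => ℝ) P.i P.s (fun j => -P.s * pd j P.g θ)

/-- A finite cover of the boundary of `Ω` by graph patches with a smooth partition of unity.
For bounded `Ω` it exists exactly if the boundary of `Ω` is a smooth hypersurface with `Ω`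
locally on one side. -/
structure BoundaryAtlas (m : ℕ) (Ω : Set (Fin (m + 1) → ℝ)) where
  r : ℕ
  patch : Fin r → GraphPatch m Ω
  χ : Fin r → (Fin (m + 1) → ℝ) → ℝ
  smooth_χ : ∀ k, ContDiff ℝ ∞ (χ k)
  nonneg_χ : ∀ k x, 0 ≤ χ k x
  compact_χ : ∀ k, HasCompactSupport (χ k)
  support_χ : ∀ k, tsupport (χ k) ⊆ (patch k).W
  sum_χ : ∀ᶠ x in 𝓝ˢ (frontier Ω), ∑ k, χ k x = 1

/-- The surface integral `∫_{∂Ω} ds_l V^l`. -/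
def BoundaryAtlas.flux {𝕜 : Type*} [RCLike 𝕜] {m : ℕ} {Ω : Set (Fin (m + 1) → ℝ)}
    (𝒜 : BoundaryAtlas m Ω) (V : (Fin (m + 1) → ℝ) → Fin (m + 1) → 𝕜) : 𝕜 :=
  ∑ k, ∫ θ : Fin m → ℝ, 𝒜.χ k ((𝒜.patch k).point θ) •
    ∑ l, (𝒜.patch k).conormal θ l • V ((𝒜.patch k).point θ) l

/-! ### Functionals of a hypersurface and of boundary data -/

/-- A functional of a hypersurface and of boundary data on it, the data being the values of
`∂_{ν₁} ⋯ ∂_{ν_Z} Φ_B` for `Z < N`. -/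
abbrev BoundaryFunctional (𝕜 : Type*) (n f N : ℕ) : Type _ :=
  (Sig : Set (Fin n → ℝ)) → (Sig → Jet 𝕜 n f N) → 𝕜

/-- A smooth one-parameter deformation of (hypersurfaces in) `ℝⁿ`, starting at the identity. -/
def IsDeformation {n : ℕ} (ψ : ℝ → (Fin n → ℝ) → (Fin n → ℝ)) : Prop :=
  ContDiff ℝ ∞ (fun p : ℝ × (Fin n → ℝ) => ψ p.1 p.2) ∧ ∀ x, ψ 0 x = x

/-- `Y` and `Z` are functional derivatives of `F` with respect to the hypersurface
`Sig = ∂Ω` and the boundary data: for every admissible variation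
`(Sig, Ψ) ↦ (ψ_ε(Sig), Ψ_ε)`,
`δF = ∫_Sig ds_l { Y^l_μ δSig^μ + Z^l δΨ }`, where `δSig = ψ_ε(x) - x` and
`δΨ = Ψ_ε(ψ_ε(x)) - Ψ_0(x)` to first order in `ε`. -/
structure IsFunctionalDerivative {𝕜 : Type*} [RCLike 𝕜] {m f N : ℕ}
    {Ω : Set (Fin (m + 1) → ℝ)} (𝒜 : BoundaryAtlas m Ω)
    (F : BoundaryFunctional 𝕜 (m + 1) f N)
    (admissible : Set ((ℝ → (Fin (m + 1) → ℝ) → (Fin (m + 1) → ℝ)) ×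
      (ℝ → (Fin (m + 1) → ℝ) → Jet 𝕜 (m + 1) f N)))
    (Y : (Fin (m + 1) → ℝ) → Fin (m + 1) → Fin (m + 1) → 𝕜)
    (Z : (Fin (m + 1) → ℝ) → Fin (m + 1) → Jet 𝕜 (m + 1) f N) : Prop where
  continuousOn_left : ContinuousOn Y (frontier Ω)
  continuousOn_right : ContinuousOn Z (frontier Ω)
  variation : ∀ v ∈ admissible,
    HasDerivAt
      (fun ε : ℝ => F (v.1 ε '' frontier Ω) (fun x => v.2 ε x))
      (𝒜.flux fun x l =>
        (∑ μ, Y x l μ * ((deriv (fun ε : ℝ => v.1 ε x μ) 0 : ℝ) : 𝕜)) +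
        ∑ k : Fin N, ∑ ν : Fin (k : ℕ) → Fin (m + 1), ∑ B : Fin f,
          Z x l k ν B * deriv (fun ε : ℝ => v.2 ε (v.1 ε x) k ν B) 0)
      0

/-- `S` is Hamilton's principal functional on the class `𝓕` of pairs (region, real movement over
it): its value at the boundary hypersurface and at the boundary values of
`Φ, …, ∂^{N-1}Φ` is the action of the real movement.  (A class is specified because a boundary
value problem can have several solutions, with different actions; `𝓕` is the branch
considered.) -/
def IsPrincipalFunctional {𝕜 : Type*} [RCLike 𝕜] {n f N : ℕ}
    (L : (Fin n → ℝ) × Jet 𝕜 n f (N + 1) → 𝕜)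
    (𝒰 : Set ((Fin n → ℝ) × Jet 𝕜 n f (N + 1)))
    (𝓕 : Set (Set (Fin n → ℝ) × ((Fin n → ℝ) → Fin f → 𝕜)))
    (S : BoundaryFunctional 𝕜 n f N) : Prop :=
  ∀ q ∈ 𝓕, IsRealMovement L 𝒰 q.1 q.2 ∧
    S (frontier q.1) (fun x => jet N q.2 x) = action L q.1 q.2

/-- The variations of the hypersurface `∂Ω` and of the boundary data of `Φ` that come from
smooth one-parameter families of regions and real movements in the class `𝓕`. -/
def realVariations {𝕜 : Type*} [RCLike 𝕜] {n f : ℕ} (N : ℕ)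
    (𝓕 : Set (Set (Fin n → ℝ) × ((Fin n → ℝ) → Fin f → 𝕜)))
    (Ω : Set (Fin n → ℝ)) (Φ : (Fin n → ℝ) → Fin f → 𝕜) :
    Set ((ℝ → (Fin n → ℝ) → (Fin n → ℝ)) × (ℝ → (Fin n → ℝ) → Jet 𝕜 n f N)) :=
  {v | IsDeformation v.1 ∧ ∃ Φs : ℝ → (Fin n → ℝ) → Fin f → 𝕜,
    ContDiff ℝ ∞ (fun p : ℝ × (Fin n → ℝ) => Φs p.1 p.2) ∧ Φs 0 = Φ ∧
    (∀ᶠ ε in 𝓝 (0 : ℝ), (v.1 ε '' Ω, Φs ε) ∈ 𝓕) ∧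
    ∀ ε x, v.2 ε x = jet N (Φs ε) x}

end HamiltonJacobi

end

/-! On the class `𝓕` the functional S is the action, so δS is the first variation of an integral
over a moving region. Pulling the integral back to the fixed Ω by `ψ ε` gives the integrand J_ε · L
evaluated at ψ_ε(x), whose ε-derivative at 0 has two sources. Moving the region contributes the
divergence of v L, where v is the velocity of ψ. Varying the fields by η = ∂_ε Φ_ε contributes the
first variation of L, which repeated integration by parts (`sum_pd_momentum`, `firstVariation_eq`)
turns into ∂_l(Σ K^{B l ν} ∂_ν η_B) plus Σ_B E_B η_B, with E_B the Euler–Lagrange expression.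
Stationarity makes E_B vanish almost everywhere in Ω (`IsRealMovement.eulerLagrange_ae_eq_zero`),
and the divergence theorem (`setIntegral_divergence`) leaves the flux of K ∂η + v L
(`hasDerivAt_action`).

The definition of S refers to data followed along the moving boundary, for which δ(∂_ν Φ_B) = ∂_ν
η_B + v^σ ∂_σ ∂_ν Φ_B. Eliminating ∂_ν η_B collects the coefficient of v^σ into exactly τ^l_σ
(`variationCurrent_eq`).

The integration by parts needs the derivatives of L to be symmetric in their indices, because the
outer index of K is treated like the inner ones. This follows by differentiating the identity that L
is unchanged by symmetrisation (`IsLagrangian.partialL_comp_equiv`).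

For the determination of Y, hold Φ fixed and move the surface by h e_σ with h arbitrary. Two pairs
of derivatives with the same K give the same δS, so the flux of h (Y - τ)_σ vanishes for every
smooth h. Localising h gives the pointwise claim. Contributions of overlapping patches cannot
cancel, since their conormals at a common boundary point are positive multiples of each other
(`GraphPatch.exists_conormal_eq_smul`, `BoundaryAtlas.conormal_sum_eq_zero`). -/

noncomputable section

namespace HamiltonJacobi

/-! ### Iterated partial derivatives, one-parameter families, differentiation under the integral -/

section Calculus

variable {n : ℕ} {F : Type*} [NormedAddCommGroup F] [NormedSpace ℝ F]

lemma contDiffOn_pd {D : Set (Fin n → ℝ)} (hD : IsOpen D) {g : (Fin n → ℝ) → F}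
    (hg : ContDiffOn ℝ ∞ g D) (i : Fin n) : ContDiffOn ℝ ∞ (pd i g) D :=
  (hg.fderiv_of_isOpen hD (by simp)).clm_apply contDiffOn_const

lemma contDiffOn_iterPD {D : Set (Fin n → ℝ)} (hD : IsOpen D) {k : ℕ} (μ : Fin k → Fin n)
    {g : (Fin n → ℝ) → F} (hg : ContDiffOn ℝ ∞ g D) : ContDiffOn ℝ ∞ (iterPD μ g) D := by
  induction k with
  | zero => exact hg
  | succ k ih => exact contDiffOn_pd hD (ih (Fin.tail μ)) _

lemma contDiff_iterPD {k : ℕ} (μ : Fin k → Fin n)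
    {g : (Fin n → ℝ) → F} (hg : ContDiff ℝ ∞ g) : ContDiff ℝ ∞ (iterPD μ g) :=
  contDiffOn_univ.1 (contDiffOn_iterPD isOpen_univ μ hg.contDiffOn)

lemma pd_congr {g h : (Fin n → ℝ) → F} {x : Fin n → ℝ} (hgh : g =ᶠ[𝓝 x] h) (i : Fin n) :
    pd i g x = pd i h x := by
  simp only [pd, hgh.fderiv_eq]

/-- The conclusion concerns germs rather than values at `x`, because the next derivative in the
induction needs agreement near each point. -/
lemma iterPD_eventuallyEq {g h : (Fin n → ℝ) → F} {x : Fin n → ℝ} (hgh : g =ᶠ[𝓝 x] h) {k : ℕ}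
    (μ : Fin k → Fin n) : iterPD μ g =ᶠ[𝓝 x] iterPD μ h := by
  induction k with
  | zero => exact hgh
  | succ k ih =>
    filter_upwards [eventually_eventually_nhds.2 (ih (Fin.tail μ))] with y hy
    exact pd_congr hy _

lemma fderiv_eq_sum_pd (g : (Fin n → ℝ) → F) (x v : Fin n → ℝ) :
    fderiv ℝ g x v = ∑ i, v i • pd i g x := by
  conv_lhs => rw [pi_eq_sum_univ' v]
  simp only [map_sum, map_smul, pd]

lemma iterPD_zero_fun {k : ℕ} (μ : Fin k → Fin n) (x : Fin n → ℝ) :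
    iterPD μ (0 : (Fin n → ℝ) → F) x = 0 := by
  have h : iterPD μ (0 : (Fin n → ℝ) → F) = 0 := by
    induction k with
    | zero => rfl
    | succ k ih =>
      funext y
      simp [iterPD, ih, pd]
  rw [h]; rfl

/-- Partial derivative of a family `G (ε, x)` in the direction of the parameter. -/
def dParam (G : ℝ × (Fin n → ℝ) → F) (p : ℝ × (Fin n → ℝ)) : F := fderiv ℝ G p (1, 0)

lemma contDiff_dParam {G : ℝ × (Fin n → ℝ) → F} (hG : ContDiff ℝ ∞ G) :
    ContDiff ℝ ∞ (dParam G) :=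
  (hG.fderiv_right (by simp)).clm_apply contDiff_const

lemma pd_slice {G : ℝ × (Fin n → ℝ) → F} {ε : ℝ} {x : Fin n → ℝ}
    (hG : DifferentiableAt ℝ G (ε, x)) (i : Fin n) :
    pd i (fun y => G (ε, y)) x = fderiv ℝ G (ε, x) (0, Pi.single i 1) := by
  have h : HasFDerivAt (fun y : Fin n → ℝ => (ε, y)) (ContinuousLinearMap.inr ℝ ℝ (Fin n → ℝ)) x :=
    hasFDerivAt_prodMk_right ε x
  have h2 := (hG.hasFDerivAt.comp x h).fderiv
  simp only [pd]
  rw [show (fun y => G (ε, y)) = G ∘ fun y => (ε, y) from rfl, h2]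
  simp

lemma hasDerivAt_slice {G : ℝ × (Fin n → ℝ) → F} {ε : ℝ} {x : Fin n → ℝ}
    (hG : DifferentiableAt ℝ G (ε, x)) :
    HasDerivAt (fun t => G (t, x)) (dParam G (ε, x)) ε := by
  have h : HasDerivAt (fun t : ℝ => (t, x)) ((1 : ℝ), (0 : Fin n → ℝ)) ε :=
    (hasDerivAt_id ε).prodMk (hasDerivAt_const ε x)
  exact hG.hasFDerivAt.comp_hasDerivAt ε h

/-- A spatial partial derivative of a slice is the total derivative applied to the constant vector
(0, e_i), so joint smoothness in parameter and point survives each differentiation. -/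
lemma contDiff_iterPD_slice {G : ℝ × (Fin n → ℝ) → F} (hG : ContDiff ℝ ∞ G) {k : ℕ}
    (μ : Fin k → Fin n) :
    ContDiff ℝ ∞ (fun p : ℝ × (Fin n → ℝ) => iterPD μ (fun y => G (p.1, y)) p.2) := by
  induction k with
  | zero => exact hG
  | succ k ih =>
    have h := ih (Fin.tail μ)
    have h2 : (fun p : ℝ × (Fin n → ℝ) => iterPD μ (fun y => G (p.1, y)) p.2) = fun p =>
        fderiv ℝ (fun p : ℝ × (Fin n → ℝ) => iterPD (Fin.tail μ) (fun y => G (p.1, y)) p.2) p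
          (0, Pi.single (μ 0) 1) := by
      funext p
      exact pd_slice (h.differentiable (by simp) _) (μ 0)
    rw [h2]
    exact (h.fderiv_right (by simp)).clm_apply contDiff_const

/-- Variation commutes with spatial differentiation: each induction step exchanges one spatial
derivative with the ε-derivative by symmetry of the second derivative. -/
lemma iterPD_dParam {G : ℝ × (Fin n → ℝ) → F} (hG : ContDiff ℝ ∞ G) {k : ℕ}
    (μ : Fin k → Fin n) (p : ℝ × (Fin n → ℝ)) :
    iterPD μ (fun y => dParam G (p.1, y)) p.2 =
      dParam (fun p : ℝ × (Fin n → ℝ) => iterPD μ (fun y => G (p.1, y)) p.2) p := by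
  induction k generalizing p with
  | zero => rfl
  | succ k ih =>
    set H := fun p : ℝ × (Fin n → ℝ) => iterPD (Fin.tail μ) (fun y => G (p.1, y)) p.2 with hH
    have h : ContDiff ℝ ∞ H := contDiff_iterPD_slice hG (Fin.tail μ)
    have e1 : iterPD μ (fun y => dParam G (p.1, y)) p.2
        = pd (μ 0) (fun y => dParam H (p.1, y)) p.2 := by
      have : iterPD (Fin.tail μ) (fun y => dParam G (p.1, y)) = fun y => dParam H (p.1, y) := by
        funext y
        exact ih (Fin.tail μ) (p.1, y)
      simp only [iterPD, this]
    have e2 : (fun p : ℝ × (Fin n → ℝ) => iterPD μ (fun y => G (p.1, y)) p.2) = fun p =>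
        fderiv ℝ H p (0, Pi.single (μ 0) 1) := by
      funext p
      exact pd_slice (h.differentiable (by simp) _) (μ 0)
    have hd : DifferentiableAt ℝ (fderiv ℝ H) p :=
      (h.fderiv_right (m := ∞) (by simp)).differentiable (by simp) p
    rw [e1, e2, pd_slice ((contDiff_dParam h).differentiable (by simp) _)]
    -- Differentiating along a constant direction gives a value of D²H, so the two sides are D²H(p)
    -- on (1, 0) and (0, e_i), in opposite orders.
    have key : ∀ v w : ℝ × (Fin n → ℝ), fderiv ℝ (fun q => fderiv ℝ H q v) p w
        = fderiv ℝ (fderiv ℝ H) p w v := by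
      intro v w
      rw [fderiv_clm_apply hd (differentiableAt_const _)]
      simp
    unfold dParam
    rw [key, key]
    exact (h.contDiffAt.isSymmSndFDerivAt (by
      rw [minSmoothness_of_isRCLikeNormedField]
      exact ENat.LEInfty.out)) _ _

end Calculus

/-- Differentiation under the integral sign for a family that is smooth near
`{0} × closure Ω`. -/
lemma hasDerivAt_setIntegral {n : ℕ} {F : Type*} [NormedAddCommGroup F] [NormedSpace ℝ F]
    {Ω : Set (Fin n → ℝ)} (hΩ : IsOpen Ω)
    (hΩb : Bornology.IsBounded Ω) {H : ℝ × (Fin n → ℝ) → F} {O : Set (ℝ × (Fin n → ℝ))}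
    (hO : IsOpen O) (hΩO : ∀ x ∈ closure Ω, ((0 : ℝ), x) ∈ O) (hH : ContDiffOn ℝ ∞ H O) :
    HasDerivAt (fun ε => ∫ x in Ω, H (ε, x)) (∫ x in Ω, dParam H (0, x)) 0 := by
  have hK : IsCompact (closure Ω) := hΩb.isCompact_closure
  have hdiff : ∀ p ∈ O, DifferentiableAt ℝ H p := fun p hp =>
    (hH.differentiableOn (by simp)).differentiableAt (hO.mem_nhds hp)
  have hcont : ContinuousOn (dParam H) O :=
    (hH.continuousOn_fderiv_of_isOpen hO (by simp)).clm_apply continuousOn_const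
  -- By the tube lemma `O` contains (interval around 0) × closure Ω. On the compact box with the
  -- half-size interval the ε-derivative is bounded by a constant, which is the dominating function.
  obtain ⟨U, V, hU, hV, h0U, hKV, hUV⟩ :=
    generalized_tube_lemma (isCompact_singleton (x := (0 : ℝ))) hK hO (by rintro ⟨a, b⟩ ⟨ha, hb⟩; obtain rfl : a = 0 := ha; exact hΩO b hb)
  obtain ⟨δ, hδ, hball⟩ := Metric.isOpen_iff.1 hU 0 (h0U rfl)
  have hsub : ∀ ε ∈ Metric.closedBall (0 : ℝ) (δ / 2), ∀ x ∈ closure Ω, (ε, x) ∈ O := by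
    intro ε hε x hx
    exact hUV ⟨hball (Metric.closedBall_subset_ball (by linarith) hε), hKV hx⟩
  have hcomp : IsCompact (Metric.closedBall (0 : ℝ) (δ / 2) ×ˢ closure Ω) :=
    (isCompact_closedBall _ _).prod hK
  obtain ⟨C, hC⟩ := hcomp.exists_bound_of_continuousOn
    (hcont.mono (by rintro ⟨a, b⟩ ⟨ha, hb⟩; exact hsub a ha b hb))
  have hslice : ∀ ε ∈ Metric.closedBall (0 : ℝ) (δ / 2),
      ContinuousOn (fun x => H (ε, x)) (closure Ω) :=
    fun ε hε => hH.continuousOn.comp (by fun_prop) (fun x hx => hsub ε hε x hx)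
  have h0 : (0 : ℝ) ∈ Metric.closedBall (0 : ℝ) (δ / 2) := Metric.mem_closedBall_self (by linarith)
  have hfin : volume Ω < ⊤ := hΩb.measure_lt_top
  refine (hasDerivAt_integral_of_dominated_loc_of_deriv_le (μ := volume.restrict Ω)
    (F := fun ε x => H (ε, x)) (F' := fun ε x => dParam H (ε, x)) (bound := fun _ => C)
    (Metric.closedBall_mem_nhds (0 : ℝ) (half_pos hδ)) ?_ ?_ ?_ ?_ ?_ ?_).2
  · filter_upwards [Metric.closedBall_mem_nhds (0 : ℝ) (half_pos hδ)] with ε hε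
    exact ((hslice ε hε).mono subset_closure).aestronglyMeasurable hΩ.measurableSet
  · exact ((hslice 0 h0).integrableOn_compact hK).mono_set subset_closure
  · refine ContinuousOn.aestronglyMeasurable ?_ hΩ.measurableSet
    exact hcont.comp (by fun_prop) (fun x hx => hsub 0 h0 x (subset_closure hx))
  · refine (ae_restrict_mem hΩ.measurableSet).mono fun x hx ε hε => ?_
    exact hC (ε, x) ⟨hε, subset_closure hx⟩
  · exact integrableOn_const hfin.ne
  · refine (ae_restrict_mem hΩ.measurableSet).mono fun x hx ε hε => ?_
    exact hasDerivAt_slice (hdiff _ (hsub ε hε x (subset_closure hx)))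

/-! ### The divergence theorem on one side of a graph -/

section Divergence

/-- Integration by parts against the constant function 1. -/
lemma integral_pd_eq_zero {n : ℕ} {F : Type*} [NormedAddCommGroup F] [NormedSpace ℝ F]
    {g : (Fin n → ℝ) → F} (hg : ContDiff ℝ ∞ g) (hc : HasCompactSupport g) (i : Fin n) :
    ∫ x, pd i g x = 0 := by
  have hcont : Continuous fun x => fderiv ℝ g x (Pi.single i 1) :=
    (hg.continuous_fderiv (by simp)).clm_apply continuous_const
  have h := integral_bilinear_hasFDerivAt_right_eq_neg_left_of_integrable (μ := volume)
    (f := fun _ : Fin n → ℝ => (1 : ℝ)) (f' := fun _ => 0) (g := g) (g' := fderiv ℝ g)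
    (v := Pi.single i 1) (B := ContinuousLinearMap.lsmul ℝ ℝ)
    (by simp)
    (by simpa using hcont.integrable_of_hasCompactSupport (hc.fderiv_apply ℝ _))
    (by simpa using hg.continuous.integrable_of_hasCompactSupport hc)
    (fun x _ => hasFDerivAt_const _ _)
    (fun x _ => (hg.differentiable (by simp) x).hasFDerivAt)
  simpa [pd] using h

variable {m : ℕ}

/-- The shear `(t, θ) ↦ (x_i = t + g θ, θ)`. -/
def shear (i : Fin (m + 1)) (g : (Fin m → ℝ) → ℝ) (p : ℝ × (Fin m → ℝ)) : Fin (m + 1) → ℝ :=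
  Fin.insertNth (α := fun _ => ℝ) i (p.1 + g p.2) p.2

lemma shear_same (i : Fin (m + 1)) (g : (Fin m → ℝ) → ℝ) (p : ℝ × (Fin m → ℝ)) :
    shear i g p i = p.1 + g p.2 := by simp [shear]

lemma shear_succAbove (i : Fin (m + 1)) (g : (Fin m → ℝ) → ℝ) (p : ℝ × (Fin m → ℝ)) (j : Fin m) :
    shear i g p (i.succAbove j) = p.2 j := by simp [shear]

lemma contDiff_shear (i : Fin (m + 1)) {g : (Fin m → ℝ) → ℝ} (hg : ContDiff ℝ ∞ g) :
    ContDiff ℝ ∞ (shear i g) := by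
  rw [contDiff_pi]
  intro l
  induction l using Fin.succAboveCases i with
  | x =>
    simp only [shear_same]
    exact contDiff_fst.add (hg.comp contDiff_snd)
  | p j =>
    simp only [shear_succAbove]
    exact (contDiff_apply ℝ ℝ j).comp contDiff_snd

/-- The shear has the continuous inverse x ↦ (x_i - g, remaining coordinates), which carries the
compact support of `v` to a compact set containing the new support. -/
lemma hasCompactSupport_comp_shear {F : Type*} [Zero F] (i : Fin (m + 1)) {g : (Fin m → ℝ) → ℝ}
    (hg : Continuous g) {v : (Fin (m + 1) → ℝ) → F} (hv : HasCompactSupport v) :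
    HasCompactSupport fun p => v (shear i g p) := by
  have hcont : Continuous fun x : Fin (m + 1) → ℝ => (x i - g (i.removeNth x), i.removeNth x) := by
    have : Continuous fun x : Fin (m + 1) → ℝ => (i.removeNth x : Fin m → ℝ) :=
      continuous_pi fun j => continuous_apply _
    fun_prop
  refine HasCompactSupport.intro (hv.isCompact.image hcont) fun p hp => ?_
  by_contra h
  refine hp ⟨shear i g p, subset_tsupport _ h, ?_⟩
  have h2 : i.removeNth (shear i g p) = p.2 := by
    funext j; exact shear_succAbove i g p j
  simp only [h2, shear_same, add_sub_cancel_right]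

/-- The shear flattens the graph and is a translation by `g θ` on each line parallel to the i-axis,
so Fubini and translation invariance suffice. -/
lemma integral_subgraph {F : Type*} [NormedAddCommGroup F] [NormedSpace ℝ F]
    (i : Fin (m + 1)) (s : ℝ) {g : (Fin m → ℝ) → ℝ} (hg : Continuous g)
    {f : (Fin (m + 1) → ℝ) → F} (hf : Integrable f) :
    ∫ x in {x | s * x i < s * g (i.removeNth x)}, f x =
      ∫ θ, ∫ t in {t | s * t < 0}, f (shear i g (t, θ)) := by
  have hrem : Continuous fun x : Fin (m + 1) → ℝ => (i.removeNth x : Fin m → ℝ) :=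
      continuous_pi fun j => continuous_apply _
  have hmeas : MeasurableSet {x : Fin (m + 1) → ℝ | s * x i < s * g (i.removeNth x)} :=
    (isOpen_lt (by fun_prop) (by fun_prop)).measurableSet
  have hmt : MeasurableSet {t : ℝ | s * t < 0} :=
    (isOpen_lt (by fun_prop) (by fun_prop)).measurableSet
  have hmp := (volume_preserving_piFinSuccAbove (fun _ : Fin (m + 1) => ℝ) i).symm
  set S := {x : Fin (m + 1) → ℝ | s * x i < s * g (i.removeNth x)} with hS
  rw [← integral_indicator hmeas, ← hmp.integral_comp']
  have hint : Integrable (fun p : ℝ × (Fin m → ℝ) => S.indicator f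
      ((MeasurableEquiv.piFinSuccAbove (fun _ : Fin (m + 1) => ℝ) i).symm p)) (volume.prod volume) :=
    (hmp.integrable_comp_emb (MeasurableEquiv.measurableEmbedding _)).2 (hf.indicator hmeas)
  rw [show (volume : Measure (ℝ × (Fin m → ℝ))) = volume.prod volume from rfl,
    integral_prod_symm _ hint]
  refine integral_congr_ae (Filter.Eventually.of_forall fun θ => ?_)
  dsimp only
  rw [← integral_indicator hmt, ← integral_add_right_eq_self _ (g θ)]
  refine integral_congr_ae (Filter.Eventually.of_forall fun t => ?_)
  have e : (MeasurableEquiv.piFinSuccAbove (fun _ : Fin (m + 1) => ℝ) i).symm (t + g θ, θ)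
      = shear i g (t, θ) := rfl
  have hr : i.removeNth (shear i g (t, θ)) = θ := by
    funext j; exact shear_succAbove i g (t, θ) j
  have hiff : shear i g (t, θ) ∈ S ↔ t ∈ {t : ℝ | s * t < 0} := by
    simp only [hS, Set.mem_ofPred_eq, shear_same, hr]
    constructor <;> intro h <;> nlinarith
  dsimp only
  rw [e]
  by_cases h : t ∈ {t : ℝ | s * t < 0}
  · rw [Set.indicator_of_mem h, Set.indicator_of_mem (hiff.2 h)]
  · rw [Set.indicator_of_notMem h, Set.indicator_of_notMem (fun h' => h (hiff.1 h'))]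

lemma isClosedEmbedding_prodMk_right {α β : Type*} [TopologicalSpace α] [TopologicalSpace β]
    [T1Space β] (b : β) : Topology.IsClosedEmbedding fun a : α => (a, b) := by
  refine ⟨isEmbedding_prodMkLeft b, ?_⟩
  have : Set.range (fun a : α => (a, b)) = Prod.snd ⁻¹' {b} := by
    ext ⟨x, y⟩
    simp [eq_comm]
  rw [this]
  exact isClosed_singleton.preimage continuous_snd

lemma isClosedEmbedding_prodMk_left {α β : Type*} [TopologicalSpace α] [TopologicalSpace β]
    [T1Space α] (a : α) : Topology.IsClosedEmbedding fun b : β => (a, b) := by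
  refine ⟨isEmbedding_prodMkRight a, ?_⟩
  have : Set.range (fun b : β => (a, b)) = Prod.fst ⁻¹' {a} := by
    ext ⟨x, y⟩
    simp [eq_comm]
  rw [this]
  exact isClosed_singleton.preimage continuous_fst

/-- The half-line ends at 0 from the left if s = 1 and from the right if s = -1; `s` is the sign of
the boundary term. -/
lemma integral_halfLine_deriv {F : Type*} [NormedAddCommGroup F] [NormedSpace ℝ F]
    [CompleteSpace F] {s : ℝ} (hs : s = 1 ∨ s = -1) {f : ℝ → F} (hf : ContDiff ℝ ∞ f)
    (hc : HasCompactSupport f) : ∫ t in {t | s * t < 0}, deriv f t = s • f 0 := by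
  rcases hs with rfl | rfl
  · have : {t : ℝ | 1 * t < 0} = Set.Iio 0 := by ext; simp
    rw [this, ← integral_Iic_eq_integral_Iio, hc.integral_Iic_deriv_eq (hf.of_le (by simp)),
      one_smul]
  · have : {t : ℝ | -1 * t < 0} = Set.Ioi 0 := by ext; simp
    rw [this, hc.integral_Ioi_deriv_eq (hf.of_le (by simp)), neg_one_smul]

lemma fderiv_shear (i : Fin (m + 1)) {g : (Fin m → ℝ) → ℝ} (hg : ContDiff ℝ ∞ g)
    (p q : ℝ × (Fin m → ℝ)) :
    fderiv ℝ (shear i g) p q =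
      Fin.insertNth (α := fun _ => ℝ) i (q.1 + fderiv ℝ g p.2 q.2) q.2 := by
  have hd := (contDiff_shear i hg).differentiable (by simp) p
  have hg' := (hg.differentiable (by simp) p.2).hasFDerivAt
  funext l
  have h1 : fderiv ℝ (shear i g) p q l = fderiv ℝ (fun x => shear i g x l) p q := by
    have := (hasFDerivAt_pi'.1 hd.hasFDerivAt l).fderiv
    rw [this]; rfl
  rw [h1]
  induction l using Fin.succAboveCases i with
  | x =>
    have : HasFDerivAt (fun x => shear i g x i) (ContinuousLinearMap.fst ℝ ℝ (Fin m → ℝ) +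
        (fderiv ℝ g p.2).comp (ContinuousLinearMap.snd ℝ ℝ (Fin m → ℝ))) p := by
      simp only [shear_same]
      exact hasFDerivAt_fst.add (hg'.comp p hasFDerivAt_snd)
    rw [this.fderiv]
    simp
  | p j =>
    have : HasFDerivAt (fun x => shear i g x (i.succAbove j))
        ((ContinuousLinearMap.proj (R := ℝ) (φ := fun _ : Fin m => ℝ) j).comp
          (ContinuousLinearMap.snd ℝ ℝ (Fin m → ℝ))) p := by
      simp only [shear_succAbove]
      exact ((ContinuousLinearMap.proj (R := ℝ) (φ := fun _ : Fin m => ℝ) j).hasFDerivAt).comp p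
        hasFDerivAt_snd
    rw [this.fderiv]
    simp

/-- The divergence theorem, one component at a time, for a subgraph. -/
lemma integral_subgraph_pd {𝕜 : Type*} [RCLike 𝕜] (i : Fin (m + 1)) {s : ℝ} (hs : s = 1 ∨ s = -1)
    {g : (Fin m → ℝ) → ℝ} (hg : ContDiff ℝ ∞ g) {v : (Fin (m + 1) → ℝ) → 𝕜}
    (hv : ContDiff ℝ ∞ v) (hc : HasCompactSupport v) (l : Fin (m + 1)) :
    ∫ x in {x | s * x i < s * g (i.removeNth x)}, pd l v x =
      ∫ θ, Fin.insertNth (α := fun _ => ℝ) i s (fun j => -s * pd j g θ) l •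
        v (Fin.insertNth (α := fun _ => ℝ) i (g θ) θ) := by
  set w : ℝ × (Fin m → ℝ) → 𝕜 := fun p => v (shear i g p) with hw
  have hsm : ContDiff ℝ ∞ w := hv.comp (contDiff_shear i hg)
  have hwc : HasCompactSupport w := hasCompactSupport_comp_shear i hg.continuous hc
  have hdw : ∀ p q, fderiv ℝ w p q = fderiv ℝ v (shear i g p)
      (Fin.insertNth (α := fun _ => ℝ) i (q.1 + fderiv ℝ g p.2 q.2) q.2) := by
    intro p q
    have h := ((hv.differentiable (by simp) _).hasFDerivAt.comp p
      ((contDiff_shear i hg).differentiable (by simp) p).hasFDerivAt).fderiv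
    rw [← fderiv_shear i hg p q]
    exact congrArg (fun A => A q) h
  have hpd_cont : Continuous (pd l v) := (hv.continuous_fderiv (by simp)).clm_apply continuous_const
  rw [integral_subgraph i s hg.continuous
    (hpd_cont.integrable_of_hasCompactSupport (hc.fderiv_apply ℝ _))]
  have hline : ∀ θ, ∫ t in {t | s * t < 0}, dParam w (t, θ) =
      s • v (Fin.insertNth (α := fun _ => ℝ) i (g θ) θ) := by
    intro θ
    have h1 : (fun t => dParam w (t, θ)) = deriv fun t => w (t, θ) := by
      funext t
      exact (hasDerivAt_slice (hsm.differentiable (by simp) _)).deriv.symm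
    have h2 : ContDiff ℝ ∞ fun t => w (t, θ) := hsm.comp (contDiff_id.prodMk contDiff_const)
    have h3 : HasCompactSupport fun t => w (t, θ) :=
      hwc.comp_isClosedEmbedding (isClosedEmbedding_prodMk_right θ)
    rw [h1, integral_halfLine_deriv hs h2 h3]
    simp [hw, shear]
  induction l using Fin.succAboveCases i with
  | x =>
    refine integral_congr_ae (Filter.Eventually.of_forall fun θ => ?_)
    have h1 : (fun t => pd i v (shear i g (t, θ))) = fun t => dParam w (t, θ) := by
      funext t
      rw [dParam, hdw]
      simp only [pd, map_zero, add_zero, Fin.insertNth_zero_right]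
    simp only [h1, hline, Fin.insertNth_apply_same]
  | p j =>
    -- In sheared coordinates a tangential derivative of v is ∂_{θ_j} w - ∂_j g · ∂_t w. The first
    -- term integrates to 0 over θ at fixed t; the second leaves the boundary term with coefficient
    -- -s ∂_j g, the tangential component of the conormal.
    set a : ℝ × (Fin m → ℝ) → 𝕜 := fun p => fderiv ℝ w p (0, Pi.single j 1) with ha
    set b : ℝ × (Fin m → ℝ) → 𝕜 := fun p => pd j g p.2 • dParam w p with hb
    have hsplit : ∀ p, pd (i.succAbove j) v (shear i g p) = a p - b p := by
      intro p
      simp only [ha, hb, dParam, hdw, pd, map_zero, add_zero, zero_add, ← map_smul, ← map_sub]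
      congr 1
      funext k
      induction k using Fin.succAboveCases i with
      | x => simp [(Fin.succAbove_ne i j).symm]
      | p k => simp [Pi.single_apply]
    have hdwc : Continuous (fderiv ℝ w) := hsm.continuous_fderiv (by simp)
    have hgc : Continuous (pd j g) := (hg.continuous_fderiv (by simp)).clm_apply continuous_const
    have hac : Continuous a := hdwc.clm_apply continuous_const
    have hbc : Continuous b := (hgc.comp continuous_snd).smul (hdwc.clm_apply continuous_const)
    have has : HasCompactSupport a := hwc.fderiv_apply ℝ _
    have hbs : HasCompactSupport b :=
      HasCompactSupport.intro hwc.isCompact fun p hp => by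
        simp [hb, dParam, fderiv_of_notMem_tsupport ℝ hp]
    have hai : Integrable a (volume.prod volume) := hac.integrable_of_hasCompactSupport has
    have hslice : ∀ {c : ℝ × (Fin m → ℝ) → 𝕜}, Continuous c → HasCompactSupport c → ∀ θ,
        Integrable fun t => c (t, θ) := fun {c} h1 h2 θ =>
      (h1.comp (by fun_prop : Continuous fun t : ℝ => (t, θ))).integrable_of_hasCompactSupport
        (h2.comp_isClosedEmbedding (isClosedEmbedding_prodMk_right θ))
    -- Fubini is applied on half-line × ℝ^m, whose measure is dominated by the full product measure,
    -- so integrability carries over.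
    have hle : (volume.restrict {t : ℝ | s * t < 0}).prod (volume : Measure (Fin m → ℝ)) ≤
        volume.prod volume := by
      have h := Measure.prod_restrict (μ := volume) (ν := (volume : Measure (Fin m → ℝ)))
        {t : ℝ | s * t < 0} Set.univ
      rw [Measure.restrict_univ] at h
      exact h.trans_le Measure.restrict_le_self
    have hai' := hai.mono_measure hle
    have hbi' := (show Integrable b (volume.prod volume) from
      hbc.integrable_of_hasCompactSupport hbs).mono_measure hle
    have hA : ∫ θ, ∫ t in {t | s * t < 0}, a (t, θ) = 0 := by
      rw [← integral_integral_swap (f := fun t θ => a (t, θ)) hai']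
      refine integral_eq_zero_of_ae (Filter.Eventually.of_forall fun t => ?_)
      have h1 : (fun θ => a (t, θ)) = pd j fun θ => w (t, θ) := by
        funext θ
        exact (pd_slice (hsm.differentiable (by simp) _) j).symm
      simp only [h1, Pi.zero_apply]
      exact integral_pd_eq_zero (hsm.comp (contDiff_const.prodMk contDiff_id))
        (hwc.comp_isClosedEmbedding (isClosedEmbedding_prodMk_left t)) j
    have hB : ∀ θ, ∫ t in {t | s * t < 0}, b (t, θ) =
        pd j g θ • s • v (Fin.insertNth (α := fun _ => ℝ) i (g θ) θ) := by
      intro θ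
      simp only [hb, integral_smul, hline]
    simp only [hsplit]
    have hsub : ∀ θ, ∫ t in {t | s * t < 0}, (a (t, θ) - b (t, θ)) =
        (∫ t in {t | s * t < 0}, a (t, θ)) - ∫ t in {t | s * t < 0}, b (t, θ) := fun θ =>
      integral_sub (hslice hac has θ).restrict (hslice hbc hbs θ).restrict
    simp only [hsub]
    rw [integral_sub hai'.integral_prod_right hbi'.integral_prod_right, hA, zero_sub,
      ← integral_neg]
    refine integral_congr_ae (Filter.Eventually.of_forall fun θ => ?_)
    simp only [hB, Fin.insertNth_apply_succAbove, ← smul_assoc, ← neg_smul]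
    congr 1
    simp [mul_comm]

end Divergence

/-! ### Surface flux and the divergence theorem on a region with a boundary atlas -/

section Flux

variable {m : ℕ} {Ω : Set (Fin (m + 1) → ℝ)} {𝕜 : Type*} [RCLike 𝕜]

namespace GraphPatch

variable (P : GraphPatch m Ω)

lemma point_eq_shear (θ : Fin m → ℝ) : P.point θ = shear P.i P.g (0, θ) := by
  simp [point, shear]

lemma point_same (θ : Fin m → ℝ) : P.point θ P.i = P.g θ := by simp [point]

lemma removeNth_point (θ : Fin m → ℝ) : P.i.removeNth (P.point θ) = θ := by
  funext j; simp [point, Fin.removeNth]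

lemma continuous_point : Continuous P.point := by
  have h : P.point = fun θ => shear P.i P.g (0, θ) := funext P.point_eq_shear
  rw [h]
  exact (contDiff_shear P.i P.smooth_g).continuous.comp (by fun_prop)

lemma continuous_conormal : Continuous P.conormal := by
  refine Continuous.finInsertNth P.i continuous_const (continuous_pi fun j => ?_)
  exact continuous_const.mul ((P.smooth_g.continuous_fderiv (by simp)).clm_apply continuous_const)

lemma s_mul_self : P.s * P.s = 1 := by
  rcases P.s_eq with h | h <;> simp [h]

lemma removeNth_add_smul_single (x : Fin (m + 1) → ℝ) (t : ℝ) :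
    P.i.removeNth (x + t • Pi.single P.i (1 : ℝ)) = P.i.removeNth x := by
  funext j
  simp [Fin.removeNth]

/-- Moving from the graph in the direction -s e_i enters Ω at once, so the point is a limit of
points of Ω. It is not in the open set Ω itself because the defining inequality is strict. -/
lemma point_mem_frontier (hΩ : IsOpen Ω) {θ : Fin m → ℝ} (hθ : P.point θ ∈ P.W) :
    P.point θ ∈ frontier Ω := by
  rw [hΩ.frontier_eq]
  refine ⟨?_, fun h => ?_⟩
  · have hc : Continuous fun t : ℝ => P.point θ + (-P.s * t) • Pi.single P.i (1 : ℝ) := by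
      fun_prop
    have ht : Filter.Tendsto (fun t : ℝ => P.point θ + (-P.s * t) • Pi.single P.i (1 : ℝ))
        (𝓝[>] 0) (𝓝 (P.point θ)) := by
      have := (hc.tendsto 0).mono_left (nhdsWithin_le_nhds (s := Set.Ioi 0))
      simpa using this
    refine mem_closure_of_tendsto ht ?_
    filter_upwards [ht.eventually (P.isOpen_W.mem_nhds hθ), self_mem_nhdsWithin] with t hW ht0
    rw [P.mem_iff _ hW, removeNth_add_smul_single, removeNth_point]
    have : (0 : ℝ) < t := ht0
    have hs := P.s_mul_self
    simp only [Pi.add_apply, point_same, Pi.smul_apply, Pi.single_eq_same, smul_eq_mul]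
    nlinarith
  · rw [P.mem_iff _ hθ, removeNth_point, point_same] at h
    exact lt_irrefl _ h

lemma hasCompactSupport_comp_point {F : Type*} [Zero F] {v : (Fin (m + 1) → ℝ) → F}
    (hv : HasCompactSupport v) : HasCompactSupport fun θ => v (P.point θ) := by
  have h := (hasCompactSupport_comp_shear P.i P.smooth_g.continuous hv).comp_isClosedEmbedding
    (isClosedEmbedding_prodMk_left (0 : ℝ))
  simp only [point_eq_shear]
  exact h

end GraphPatch

namespace BoundaryAtlas

variable (𝒜 : BoundaryAtlas m Ω)

/-- The graph of a patch is known to lie on the boundary only inside `W`; the cutoff discards the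
rest. Hence the flux sees a field only through its values on the frontier. -/
lemma point_mem_frontier_of_χ (hΩ : IsOpen Ω) {k : Fin 𝒜.r} {θ : Fin m → ℝ}
    (h : 𝒜.χ k ((𝒜.patch k).point θ) ≠ 0) : (𝒜.patch k).point θ ∈ frontier Ω :=
  (𝒜.patch k).point_mem_frontier hΩ (𝒜.support_χ k (subset_tsupport _ h))

lemma flux_congr (hΩ : IsOpen Ω) {V V' : (Fin (m + 1) → ℝ) → Fin (m + 1) → 𝕜}
    (h : ∀ x ∈ frontier Ω, V x = V' x) : 𝒜.flux V = 𝒜.flux V' := by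
  refine Finset.sum_congr rfl fun k _ => integral_congr_ae (Filter.Eventually.of_forall fun θ => ?_)
  by_cases hχ : 𝒜.χ k ((𝒜.patch k).point θ) = 0
  · simp [hχ]
  · simp only [h _ (𝒜.point_mem_frontier_of_χ hΩ hχ)]

lemma hasCompactSupport_χ_point (k : Fin 𝒜.r) {F : Type*} [AddCommGroup F] [Module ℝ F]
    (c : (Fin m → ℝ) → F) :
    HasCompactSupport fun θ => 𝒜.χ k ((𝒜.patch k).point θ) • c θ :=
  HasCompactSupport.intro ((𝒜.patch k).hasCompactSupport_comp_point (𝒜.compact_χ k)).isCompact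
    fun θ hθ => by
      have : 𝒜.χ k ((𝒜.patch k).point θ) = 0 := image_eq_zero_of_notMem_tsupport
        (f := fun θ => 𝒜.χ k ((𝒜.patch k).point θ)) hθ
      simp [this]

lemma continuous_χ_point (k : Fin 𝒜.r)
    {c : (Fin m → ℝ) → 𝕜} (hc : ∀ θ, (𝒜.patch k).point θ ∈ (𝒜.patch k).W → ContinuousAt c θ) :
    Continuous fun θ => 𝒜.χ k ((𝒜.patch k).point θ) • c θ := by
  refine continuous_of_tsupport fun θ hθ => ?_
  have h1 : (𝒜.patch k).point θ ∈ tsupport (𝒜.χ k) := by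
    have hcl : IsClosed ((𝒜.patch k).point ⁻¹' tsupport (𝒜.χ k)) :=
      (isClosed_tsupport _).preimage (𝒜.patch k).continuous_point
    refine closure_minimal (fun θ' h' => ?_) hcl hθ
    refine subset_tsupport _ fun h0 => h' ?_
    simp [h0]
  exact ((𝒜.smooth_χ k).continuous.comp (𝒜.patch k).continuous_point).continuousAt.smul
    (hc θ (𝒜.support_χ k h1))

lemma continuousAt_comp_point (hΩ : IsOpen Ω) {P : GraphPatch m Ω} {E : Type*} [TopologicalSpace E]
    {u : (Fin (m + 1) → ℝ) → E} (hu : ContinuousOn u (frontier Ω)) {θ : Fin m → ℝ}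
    (hθ : P.point θ ∈ P.W) : ContinuousAt (fun θ => u (P.point θ)) θ := by
  have h1 := hu _ (P.point_mem_frontier hΩ hθ)
  refine h1.tendsto.comp (tendsto_nhdsWithin_iff.2 ⟨P.continuous_point.continuousAt, ?_⟩)
  filter_upwards [P.continuous_point.continuousAt.eventually (P.isOpen_W.mem_nhds hθ)] with θ' h'
  exact P.point_mem_frontier hΩ h'

lemma continuous_fluxIntegrand (hΩ : IsOpen Ω) (k : Fin 𝒜.r)
    {V : (Fin (m + 1) → ℝ) → Fin (m + 1) → 𝕜} (hV : ContinuousOn V (frontier Ω)) :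
    Continuous fun θ => 𝒜.χ k ((𝒜.patch k).point θ) •
      ∑ l, (𝒜.patch k).conormal θ l • V ((𝒜.patch k).point θ) l := by
  refine 𝒜.continuous_χ_point k fun θ hθ => ?_
  have h1 := continuousAt_pi.1 (continuousAt_comp_point hΩ hV hθ)
  refine tendsto_finsetSum _ fun l _ => ?_
  exact ((continuous_apply l).comp (𝒜.patch k).continuous_conormal).continuousAt.smul (h1 l)

lemma integrable_fluxIntegrand (hΩ : IsOpen Ω) (k : Fin 𝒜.r)
    {V : (Fin (m + 1) → ℝ) → Fin (m + 1) → 𝕜} (hV : ContinuousOn V (frontier Ω)) :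
    Integrable fun θ => 𝒜.χ k ((𝒜.patch k).point θ) •
      ∑ l, (𝒜.patch k).conormal θ l • V ((𝒜.patch k).point θ) l :=
  (𝒜.continuous_fluxIntegrand hΩ k hV).integrable_of_hasCompactSupport
    (𝒜.hasCompactSupport_χ_point k _)

lemma flux_sub (hΩ : IsOpen Ω) {V V' : (Fin (m + 1) → ℝ) → Fin (m + 1) → 𝕜}
    (hV : ContinuousOn V (frontier Ω)) (hV' : ContinuousOn V' (frontier Ω)) :
    𝒜.flux (fun x l => V x l - V' x l) = 𝒜.flux V - 𝒜.flux V' := by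
  simp only [flux, ← Finset.sum_sub_distrib]
  refine Finset.sum_congr rfl fun k _ => ?_
  rw [← integral_sub (𝒜.integrable_fluxIntegrand hΩ k hV) (𝒜.integrable_fluxIntegrand hΩ k hV')]
  simp only [smul_sub, Finset.sum_sub_distrib]

end BoundaryAtlas

/-- On the support of `v` the set Ω coincides with the subgraph, and elsewhere the integrand is
zero. -/
lemma GraphPatch.setIntegral_pd (P : GraphPatch m Ω) (hΩ : IsOpen Ω)
    {v : (Fin (m + 1) → ℝ) → 𝕜} (hv : ContDiff ℝ ∞ v) (hc : HasCompactSupport v)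
    (hW : tsupport v ⊆ P.W) (l : Fin (m + 1)) :
    ∫ x in Ω, pd l v x = ∫ θ, P.conormal θ l • v (P.point θ) := by
  have h := integral_subgraph_pd P.i P.s_eq P.smooth_g hv hc l
  have hrem : Continuous fun x : Fin (m + 1) → ℝ => (P.i.removeNth x : Fin m → ℝ) :=
    continuous_pi fun j => continuous_apply _
  have hmeas : MeasurableSet {x : Fin (m + 1) → ℝ | P.s * x P.i < P.s * P.g (P.i.removeNth x)} :=
    (isOpen_lt (by fun_prop) (continuous_const.mul (P.smooth_g.continuous.comp hrem))).measurableSet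
  refine Eq.trans ?_ h
  rw [← integral_indicator hΩ.measurableSet, ← integral_indicator hmeas]
  refine integral_congr_ae (Filter.Eventually.of_forall fun x => ?_)
  by_cases hx : x ∈ tsupport v
  · have := P.mem_iff x (hW hx)
    simp only [Set.indicator, Set.mem_ofPred_eq, this]
  · have h0 : pd l v x = 0 := by simp [pd, fderiv_of_notMem_tsupport ℝ hx]
    simp [Set.indicator, h0]

/-- As `v` vanishes near the frontier, cutting it off to zero outside Ω keeps it smooth, and the
integral becomes one over the whole space. -/
lemma setIntegral_pd_eq_zero (hΩ : IsOpen Ω) {v : (Fin (m + 1) → ℝ) → 𝕜} (hv : ContDiff ℝ ∞ v)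
    (hc : HasCompactSupport v) (h0 : ∀ x ∈ frontier Ω, v =ᶠ[𝓝 x] 0) (l : Fin (m + 1)) :
    ∫ x in Ω, pd l v x = 0 := by
  have hcase : ∀ x, Ω.indicator v =ᶠ[𝓝 x] v ∧ Ω.indicator (pd l v) x = pd l v x ∨
      Ω.indicator v =ᶠ[𝓝 x] 0 ∧ Ω.indicator (pd l v) x = 0 := by
    intro x
    by_cases hx : x ∈ Ω
    · refine Or.inl ⟨?_, by simp [hx]⟩
      filter_upwards [hΩ.mem_nhds hx] with y hy
      simp [hy]
    · refine Or.inr ⟨?_, by simp [hx]⟩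
      by_cases hcl : x ∈ closure Ω
      · filter_upwards [h0 x (by rw [hΩ.frontier_eq]; exact ⟨hcl, hx⟩)] with y hy
        by_cases hyΩ : y ∈ Ω <;> simp [hyΩ, hy]
      · filter_upwards [isClosed_closure.isOpen_compl.mem_nhds hcl] with y hy
        have : y ∉ Ω := fun h => hy (subset_closure h)
        simp [this]
  have hsm : ContDiff ℝ ∞ (Ω.indicator v) := by
    refine contDiff_iff_contDiffAt.2 fun x => ?_
    rcases hcase x with ⟨h, -⟩ | ⟨h, -⟩
    · exact hv.contDiffAt.congr_of_eventuallyEq h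
    · exact contDiffAt_const.congr_of_eventuallyEq h
  have hpd : Ω.indicator (pd l v) = pd l (Ω.indicator v) := by
    funext x
    rcases hcase x with ⟨h, h'⟩ | ⟨h, h'⟩
    · rw [h', pd_congr h]
    · rw [h', pd_congr h]
      simp [pd]
  rw [← integral_indicator hΩ.measurableSet, hpd]
  exact integral_pd_eq_zero hsm (HasCompactSupport.intro hc.isCompact fun x hx => by
    simp [Set.indicator, image_eq_zero_of_notMem_tsupport hx]) l

lemma exists_cutoff {n : ℕ} {K D : Set (Fin n → ℝ)} (hK : IsCompact K) (hD : IsOpen D)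
    (hKD : K ⊆ D) : ∃ ρ : (Fin n → ℝ) → ℝ, ContDiff ℝ ∞ ρ ∧ HasCompactSupport ρ ∧
      tsupport ρ ⊆ D ∧ ∀ᶠ x in 𝓝ˢ K, ρ x = 1 := by
  obtain ⟨L, hL, hKL, hLD⟩ := exists_compact_between hK hD hKD
  obtain ⟨f, hf1, hf0, -⟩ := exists_contMDiffMap_one_nhds_of_subset_interior (n := ⊤)
    (modelWithCornersSelf ℝ (Fin n → ℝ)) hK.isClosed hKL
  have hts : tsupport f ⊆ L := closure_minimal (fun x hx => by
    by_contra h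
    exact hx (hf0 x h)) hL.isClosed
  exact ⟨f, f.contMDiff.contDiff, HasCompactSupport.intro hL fun x hx => hf0 x hx,
    hts.trans hLD, hf1⟩

lemma contDiff_smul_of_tsupport {n : ℕ} {D : Set (Fin n → ℝ)} (hD : IsOpen D)
    {ρ : (Fin n → ℝ) → ℝ} (hρ : ContDiff ℝ ∞ ρ) (hρD : tsupport ρ ⊆ D) {v : (Fin n → ℝ) → 𝕜}
    (hv : ContDiffOn ℝ ∞ v D) : ContDiff ℝ ∞ fun x => ρ x • v x := by
  refine contDiff_iff_contDiffAt.2 fun x => ?_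
  by_cases hx : x ∈ tsupport ρ
  · exact hρ.contDiffAt.smul (hv.contDiffAt (hD.mem_nhds (hρD hx)))
  · refine (contDiffAt_const (c := (0 : 𝕜))).congr_of_eventuallyEq ?_
    filter_upwards [notMem_tsupport_iff_eventuallyEq.1 hx] with y hy
    simp [hy]

/-- Split v into the pieces χ_k v, each supported in one patch, and the remainder v - Σ χ_k v, which
vanishes near the frontier and contributes nothing. -/
lemma setIntegral_pd_eq_sum (hΩ : IsOpen Ω) (𝒜 : BoundaryAtlas m Ω)
    {v : (Fin (m + 1) → ℝ) → 𝕜} (hv : ContDiff ℝ ∞ v) (hc : HasCompactSupport v)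
    (l : Fin (m + 1)) :
    ∫ x in Ω, pd l v x = ∑ k, ∫ θ, 𝒜.χ k ((𝒜.patch k).point θ) •
      (𝒜.patch k).conormal θ l • v ((𝒜.patch k).point θ) := by
  set w : Fin 𝒜.r → (Fin (m + 1) → ℝ) → 𝕜 := fun k x => 𝒜.χ k x • v x with hw
  have hwsm : ∀ k, ContDiff ℝ ∞ (w k) := fun k => (𝒜.smooth_χ k).smul hv
  have hwc : ∀ k, HasCompactSupport (w k) := fun k => HasCompactSupport.intro hc.isCompact
    fun x hx => by simp [hw, image_eq_zero_of_notMem_tsupport hx]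
  set u : (Fin (m + 1) → ℝ) → 𝕜 := fun x => v x - ∑ k, w k x with hu
  have husm : ContDiff ℝ ∞ u := hv.sub (ContDiff.sum fun k _ => hwsm k)
  have huc : HasCompactSupport u := HasCompactSupport.intro hc.isCompact
    fun x hx => by simp [hu, hw, image_eq_zero_of_notMem_tsupport hx]
  have hint : ∀ {f : (Fin (m + 1) → ℝ) → 𝕜}, ContDiff ℝ ∞ f → HasCompactSupport f →
      IntegrableOn (pd l f) Ω := fun {f} h1 h2 =>
    (((h1.continuous_fderiv (by simp)).clm_apply continuous_const).integrable_of_hasCompactSupport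
      (h2.fderiv_apply ℝ (Pi.single l 1))).integrableOn
  have hpd : ∀ x, pd l v x = pd l u x + ∑ k, pd l (w k) x := by
    intro x
    have h1 : HasFDerivAt u (fderiv ℝ v x - ∑ k, fderiv ℝ (w k) x) x :=
      (hv.differentiable (by simp) x).hasFDerivAt.sub
        (HasFDerivAt.fun_sum fun k _ => ((hwsm k).differentiable (by simp) x).hasFDerivAt)
    simp [pd, h1.fderiv]
  have hu0 : ∫ x in Ω, pd l u x = 0 := by
    refine setIntegral_pd_eq_zero hΩ husm huc (fun x hx => ?_) l
    filter_upwards [(eventually_nhdsSet_iff_forall.1 𝒜.sum_χ) x hx] with y hy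
    simp [hu, hw, ← Finset.sum_smul, hy]
  simp only [hpd]
  rw [integral_add (hint husm huc) (integrable_finsetSum _ fun k _ => hint (hwsm k) (hwc k)), hu0,
    zero_add, integral_finsetSum _ fun k _ => hint (hwsm k) (hwc k)]
  refine Finset.sum_congr rfl fun k _ => ?_
  rw [(𝒜.patch k).setIntegral_pd hΩ (hwsm k) (hwc k)]
  · refine integral_congr_ae (Filter.Eventually.of_forall fun θ => ?_)
    exact smul_comm _ _ _
  · exact (closure_mono (Function.support_smul_subset_left (𝒜.χ k) v)).trans (𝒜.support_χ k)

/-- The divergence theorem. -/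
theorem setIntegral_divergence (hΩ : IsOpen Ω) (hΩb : Bornology.IsBounded Ω)
    (𝒜 : BoundaryAtlas m Ω) {D : Set (Fin (m + 1) → ℝ)} (hD : IsOpen D) (hΩD : closure Ω ⊆ D)
    {V : Fin (m + 1) → (Fin (m + 1) → ℝ) → 𝕜} (hV : ∀ l, ContDiffOn ℝ ∞ (V l) D) :
    ∫ x in Ω, ∑ l, pd l (V l) x = 𝒜.flux fun x l => V l x := by
  have hK := hΩb.isCompact_closure
  -- `V` is smooth only near the closure of Ω. The field ρ V is globally smooth with compact support
  -- and has the same germ at each point of that closure.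
  obtain ⟨ρ, hρ, hρc, hρD, hρ1⟩ := exists_cutoff hK hD hΩD
  set V' : Fin (m + 1) → (Fin (m + 1) → ℝ) → 𝕜 := fun l x => ρ x • V l x with hV'
  have hsm : ∀ l, ContDiff ℝ ∞ (V' l) := fun l => contDiff_smul_of_tsupport hD hρ hρD (hV l)
  have hc : ∀ l, HasCompactSupport (V' l) := fun l => HasCompactSupport.intro hρc.isCompact
    fun x hx => by simp [hV', image_eq_zero_of_notMem_tsupport hx]
  have heq : ∀ x ∈ closure Ω, ∀ l, V' l =ᶠ[𝓝 x] V l := by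
    intro x hx l
    filter_upwards [(eventually_nhdsSet_iff_forall.1 hρ1) x hx] with y hy
    simp [hV', hy]
  have h1 : ∫ x in Ω, ∑ l, pd l (V l) x = ∫ x in Ω, ∑ l, pd l (V' l) x :=
    setIntegral_congr_fun hΩ.measurableSet fun x hx =>
      Finset.sum_congr rfl fun l _ => (pd_congr (heq x (subset_closure hx) l) l).symm
  have h2 : 𝒜.flux (fun x l => V l x) = 𝒜.flux fun x l => V' l x :=
    𝒜.flux_congr hΩ fun x hx => funext fun l =>
      ((heq x (frontier_subset_closure hx) l).self_of_nhds).symm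
  rw [h1, h2, integral_finsetSum]
  · simp only [setIntegral_pd_eq_sum hΩ 𝒜 (hsm _) (hc _), BoundaryAtlas.flux]
    rw [Finset.sum_comm]
    refine Finset.sum_congr rfl fun k _ => ?_
    rw [← integral_finsetSum]
    · simp only [Finset.smul_sum]
    · intro l _
      refine Continuous.integrable_of_hasCompactSupport ?_ (𝒜.hasCompactSupport_χ_point k _)
      exact ((𝒜.smooth_χ k).continuous.comp (𝒜.patch k).continuous_point).smul
        (((continuous_apply l).comp (𝒜.patch k).continuous_conormal).smul
          ((hsm l).continuous.comp (𝒜.patch k).continuous_point))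
  · intro l _
    exact (((hsm l).continuous_fderiv (by simp)).clm_apply
      continuous_const).integrable_of_hasCompactSupport
      ((hc l).fderiv_apply ℝ (Pi.single l 1)) |>.integrableOn

end Flux

/-! ### Derivatives of the Lagrangian and their symmetry in the indices -/

section Lagrangian

variable {𝕜 : Type*} [RCLike 𝕜] {n f N : ℕ}
  {L : (Fin n → ℝ) × Jet 𝕜 n f (N + 1) → 𝕜} {𝒰 : Set ((Fin n → ℝ) × Jet 𝕜 n f (N + 1))}

/-- The jet variable conjugate to `∂_μ Φ_B`. -/
def jetBasis {k : ℕ} (X : Fin k) (μ : Fin (X : ℕ) → Fin n) (B : Fin f) : Jet 𝕜 n f k :=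
  Pi.single X (Pi.single μ (Pi.single B 1))

lemma jet_eq_sum {k : ℕ} (u : Jet 𝕜 n f k) :
    u = ∑ X, ∑ μ, ∑ B, u X μ B • (jetBasis X μ B : Jet 𝕜 n f k) := by
  funext X μ B
  simp only [Finset.sum_apply, Pi.smul_apply, jetBasis, smul_eq_mul]
  rw [Finset.sum_eq_single X, Finset.sum_eq_single μ, Finset.sum_eq_single B]
  · simp
  · intro b _ hb; simp [hb.symm]
  · simp
  · intro b _ hb; simp [hb.symm]
  · simp
  · intro b _ hb; simp [hb.symm]
  · simp

namespace IsLagrangian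

lemma contDiffAt (hL : IsLagrangian L 𝒰) {p} (hp : p ∈ 𝒰) : ContDiffAt ℝ ∞ L p :=
  hL.smooth.contDiffAt (hL.isOpen.mem_nhds hp)

/-- The momenta are built from the `𝕜`-derivative in the jet variables, while smoothness is real.
Restricting scalars in the former gives the real derivative, to which the real calculus applies. -/
lemma fderiv_snd (hL : IsLagrangian L 𝒰) {p} (hp : p ∈ 𝒰) (w : Jet 𝕜 n f (N + 1)) :
    fderiv 𝕜 (fun u => L (p.1, u)) p.2 w = fderiv ℝ L p (0, w) := by
  have h1 := (hL.differentiable p hp).fderiv_restrictScalars ℝ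
  have h2 : HasFDerivAt (fun u => L (p.1, u))
      ((fderiv ℝ L p).comp (ContinuousLinearMap.inr ℝ (Fin n → ℝ) (Jet 𝕜 n f (N + 1)))) p.2 :=
    ((hL.contDiffAt hp).differentiableAt (by simp)).hasFDerivAt.comp p.2
      (hasFDerivAt_prodMk_right p.1 p.2)
  rw [h2.fderiv] at h1
  have h3 := congrArg (fun A => A w) h1
  simpa using h3.symm

lemma partialL_eq (hL : IsLagrangian L 𝒰) {p} (hp : p ∈ 𝒰) (X : Fin (N + 1))
    (μ : Fin (X : ℕ) → Fin n) (B : Fin f) :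
    partialL L μ B p = fderiv ℝ L p (0, jetBasis X μ B) := by
  rw [← hL.fderiv_snd hp, partialL, dif_pos X.2]
  rfl

lemma contDiffOn_partialL (hL : IsLagrangian L 𝒰) {X : ℕ} (μ : Fin X → Fin n) (B : Fin f) :
    ContDiffOn ℝ ∞ (partialL L μ B) 𝒰 := by
  by_cases hX : X < N + 1
  · refine ((hL.smooth.fderiv_of_isOpen hL.isOpen (m := ∞) (by simp)).clm_apply
      (contDiffOn_const (c := ((0 : Fin n → ℝ), jetBasis ⟨X, hX⟩ μ B)))).congr fun p hp => ?_
    exact hL.partialL_eq hp ⟨X, hX⟩ μ B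
  · have : partialL L μ B = fun _ => 0 := by
      funext p; simp [partialL, hX]
    rw [this]
    exact contDiffOn_const

/-- Symmetrisation of jets as a continuous linear map. -/
def symJetCLM (𝕜 : Type*) [RCLike 𝕜] (n f k : ℕ) : Jet 𝕜 n f k →L[ℝ] Jet 𝕜 n f k where
  toFun := symJet
  map_add' u v := by
    funext X μ B
    simp [symJet, Finset.sum_add_distrib, mul_add]
  map_smul' c u := by
    funext X μ B
    simp [symJet, ← Finset.smul_sum]
  cont := by
    unfold symJet
    fun_prop

/-- Right multiplication by `σ` permutes the summands of the average over permutations. -/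
lemma symJet_jetBasis_comp {k : ℕ} (X : Fin k) (μ : Fin (X : ℕ) → Fin n)
    (σ : Equiv.Perm (Fin (X : ℕ))) (B : Fin f) :
    symJet (jetBasis X (μ ∘ σ) B : Jet 𝕜 n f k) = symJet (jetBasis X μ B) := by
  funext X' μ' B'
  simp only [symJet]
  congr 1
  by_cases hX : X' = X
  · subst hX
    simp only [jetBasis, Pi.single_eq_same]
    rw [← Equiv.sum_comp (Equiv.mulRight σ)]
    refine Finset.sum_congr rfl fun P _ => ?_
    have : ((fun j => μ' ((Equiv.mulRight σ P) j)) = μ ∘ σ) ↔ (fun j => μ' (P j)) = μ := by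
      constructor
      · intro h
        funext j
        have := congrFun h (σ⁻¹ j)
        simpa using this
      · rintro rfl
        rfl
    by_cases h : (fun j => μ' (P j)) = μ
    · rw [Pi.single_apply, Pi.single_apply, if_pos (this.2 h), if_pos h]
    · rw [Pi.single_apply, Pi.single_apply, if_neg (fun h' => h (this.1 h')), if_neg h]
  · simp [jetBasis, hX]

/-- Differentiating L = L ∘ sym on the open set `𝒰` gives DL(p) w = DL(sym p)(sym w), and sym w
forgets the order of the indices. Allowing an equivalence between differently written lengths also
absorbs the casts between Y + 1 + Z and Y + Z + 1. -/
lemma partialL_comp_equiv (hL : IsLagrangian L 𝒰) {p} (hp : p ∈ 𝒰) {X X' : ℕ}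
    (e : Fin X ≃ Fin X') (μ : Fin X' → Fin n) (B : Fin f) :
    partialL L (μ ∘ e) B p = partialL L μ B p := by
  obtain rfl : X = X' := by simpa using Fintype.card_congr e
  by_cases hX : X < N + 1
  · have key : ∀ w, fderiv ℝ L p (0, w) = fderiv ℝ L (p.1, symJet p.2) (0, symJet w) := by
      intro w
      have h1 : L =ᶠ[𝓝 p] fun q => L (q.1, symJet q.2) := by
        filter_upwards [hL.isOpen.mem_nhds hp] with q hq
        exact (hL.symm q hq).2.symm
      have h2 : HasFDerivAt (fun q : (Fin n → ℝ) × Jet 𝕜 n f (N + 1) => (q.1, symJet q.2))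
          ((ContinuousLinearMap.fst ℝ (Fin n → ℝ) (Jet 𝕜 n f (N + 1))).prod
            ((symJetCLM 𝕜 n f (N + 1)).comp
              (ContinuousLinearMap.snd ℝ (Fin n → ℝ) (Jet 𝕜 n f (N + 1))))) p :=
        ((ContinuousLinearMap.fst ℝ (Fin n → ℝ) (Jet 𝕜 n f (N + 1))).prod
            ((symJetCLM 𝕜 n f (N + 1)).comp
              (ContinuousLinearMap.snd ℝ (Fin n → ℝ) (Jet 𝕜 n f (N + 1))))).hasFDerivAt
      have h3 := (((hL.contDiffAt (hL.symm p hp).1).differentiableAt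
        (by simp)).hasFDerivAt.comp p h2).fderiv
      rw [h1.fderiv_eq]
      exact congrArg (fun A => A (0, w)) h3
    rw [hL.partialL_eq hp ⟨X, hX⟩, hL.partialL_eq hp ⟨X, hX⟩, key,
      key (jetBasis ⟨X, hX⟩ μ B), symJet_jetBasis_comp ⟨X, hX⟩]
  · simp [partialL, hX]

lemma fderiv_apply_jet (hL : IsLagrangian L 𝒰) {p} (hp : p ∈ 𝒰) (w : Jet 𝕜 n f (N + 1)) :
    fderiv ℝ L p (0, w) = ∑ X, ∑ μ, ∑ B, w X μ B * partialL L μ B p := by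
  rw [← hL.fderiv_snd hp]
  conv_lhs => rw [jet_eq_sum w]
  simp only [map_sum, map_smul, smul_eq_mul]
  simp only [hL.fderiv_snd hp, hL.partialL_eq hp]

end IsLagrangian

end Lagrangian

/-! ### Integration by parts and the momenta -/

section Momentum

variable {n : ℕ}

/-- This lemma and the next two compare index tuples up to relabelling. The coefficients they are
fed to are symmetric, so the mere existence of a relabelling is enough. -/
lemma append_comp_equiv {α : Type*} {k j : ℕ} (u : Fin k → α) (e : Equiv.Perm (Fin k))
    (v : Fin j → α) : ∃ E : Equiv.Perm (Fin (k + j)),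
      Fin.append (u ∘ e) v = Fin.append u v ∘ E := by
  refine ⟨(finSumFinEquiv.symm.trans (Equiv.sumCongr e (Equiv.refl _))).trans finSumFinEquiv, ?_⟩
  funext i
  induction i using Fin.addCases <;> simp

lemma append_cons_left_equiv {α : Type*} {k j : ℕ} (a : α) (u : Fin k → α) (v : Fin j → α) :
    ∃ e : Fin (k + 1 + j) ≃ Fin (k + j + 1),
      Fin.append (Fin.cons a u : Fin (k + 1) → α) v = Fin.cons a (Fin.append u v) ∘ e :=
  ⟨finCongr (Nat.add_right_comm k 1 j), Fin.append_cons a u v⟩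

lemma append_cons_right_equiv {α : Type*} {k j : ℕ} (a : α) (u : Fin k → α) (v : Fin j → α) :
    ∃ e : Fin (k + (j + 1)) ≃ Fin (k + j + 1),
      Fin.append u (Fin.cons a v : Fin (j + 1) → α) = Fin.cons a (Fin.append u v) ∘ e := by
  -- `a` is first attached to the end of `u`; the rotation then brings it to the front of that
  -- block.
  obtain ⟨E, hE⟩ := append_comp_equiv (Fin.cons a u : Fin (k + 1) → α) (finRotate _) v
  obtain ⟨e, he⟩ := append_cons_left_equiv a u v
  refine ⟨(finCongr (Nat.succ_add_eq_add_succ k j).symm).trans (E.trans e), ?_⟩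
  rw [Fin.append_right_cons, Fin.snoc_eq_cons_rotate]
  change Fin.append ((Fin.cons a u : Fin (k + 1) → α) ∘ finRotate _) v ∘ _ = _
  rw [hE, he]
  rfl

lemma sum_fin_cons {α M : Type*} [Fintype α] [AddCommMonoid M] {k : ℕ}
    (F : (Fin (k + 1) → α) → M) :
    ∑ b, F b = ∑ l, ∑ a : Fin k → α, F (Fin.cons l a) := by
  rw [← Fintype.sum_prod_type']
  exact (Equiv.sum_comp (Fin.consEquiv fun _ => α) F).symm

/-- On the antidiagonal Y + Z + 1 = X the terms telescope, leaving the two ends A 0 X and -(-1)^X A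
X 0; the summand X = 0 on the right is zero. Induction on `N` adds one antidiagonal at a time. -/
lemma alternating_telescope {M : Type*} [CommRing M] (A : ℕ → ℕ → M) (N : ℕ) :
    ∑ Z ∈ Finset.range N, ∑ Y ∈ Finset.range (N - Z), (-1) ^ Y * (A (Y + 1) Z + A Y (Z + 1)) =
      ∑ X ∈ Finset.range (N + 1), (A 0 X - (-1) ^ X * A X 0) := by
  induction N with
  | zero => simp
  | succ N ih =>
    rw [Finset.sum_range_succ (fun X => A 0 X - (-1) ^ X * A X 0), ← ih]
    have h1 : ∀ Z ∈ Finset.range (N + 1), ∑ Y ∈ Finset.range (N + 1 - Z),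
        (-1) ^ Y * (A (Y + 1) Z + A Y (Z + 1)) =
        ∑ Y ∈ Finset.range (N - Z), (-1) ^ Y * (A (Y + 1) Z + A Y (Z + 1)) +
          ((-1) ^ (N + 1 - (Z + 1)) * A (N + 1 - (Z + 1)) (Z + 1) -
            (-1) ^ (N + 1 - Z) * A (N + 1 - Z) Z) := by
      intro Z hZ
      have hZ' : Z ≤ N := Nat.lt_succ_iff.1 (Finset.mem_range.1 hZ)
      rw [show N + 1 - Z = N - Z + 1 by omega, Finset.sum_range_succ,
        show N + 1 - (Z + 1) = N - Z by omega]
      ring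
    rw [Finset.sum_congr rfl h1, Finset.sum_add_distrib,
      Finset.sum_range_sub (fun Z => (-1) ^ (N + 1 - Z) * A (N + 1 - Z) Z), Finset.sum_range_succ]
    simp

lemma pd_mul {𝕜 : Type*} [RCLike 𝕜] {u v : (Fin n → ℝ) → 𝕜} {x : Fin n → ℝ}
    (hu : DifferentiableAt ℝ u x) (hv : DifferentiableAt ℝ v x) (l : Fin n) :
    pd l (fun y => u y * v y) x = pd l u x * v x + u x * pd l v x := by
  simp only [pd]
  rw [(hu.hasFDerivAt.fun_mul hv.hasFDerivAt).fderiv]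
  simp [mul_comm, add_comm]

lemma pd_sum {𝕜 : Type*} [RCLike 𝕜] {ι : Type*} (t : Finset ι) {u : ι → (Fin n → ℝ) → 𝕜}
    {x : Fin n → ℝ} (hu : ∀ a ∈ t, DifferentiableAt ℝ (u a) x) (l : Fin n) :
    pd l (fun y => ∑ a ∈ t, u a y) x = ∑ a ∈ t, pd l (u a) x := by
  simp only [pd]
  rw [(HasFDerivAt.fun_sum fun a ha => (hu a ha).hasFDerivAt).fderiv]
  simp

lemma pd_const_mul {𝕜 : Type*} [RCLike 𝕜] (c : 𝕜) {v : (Fin n → ℝ) → 𝕜} {x : Fin n → ℝ}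
    (hv : DifferentiableAt ℝ v x) (l : Fin n) :
    pd l (fun y => c * v y) x = c * pd l v x := by
  rw [pd_mul (differentiableAt_const c) hv]
  simp [pd]

variable {𝕜 : Type*} [RCLike 𝕜]

/-- The integration by parts identity behind the momenta: `q` stands for the derivatives of a
Lagrangian with respect to the (symmetrised) derivatives of one field, `h` for a variation of that
field. -/
lemma sum_pd_momentum {D : Set (Fin n → ℝ)} (hD : IsOpen D)
    {q : {X : ℕ} → (Fin X → Fin n) → (Fin n → ℝ) → 𝕜}
    (hq : ∀ {X : ℕ} (μ : Fin X → Fin n), ContDiffOn ℝ ∞ (q μ) D)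
    (hsym : ∀ {X X' : ℕ} (e : Fin X ≃ Fin X') (μ : Fin X' → Fin n), ∀ y ∈ D, q (μ ∘ e) y = q μ y)
    {h : (Fin n → ℝ) → 𝕜} (hh : ContDiff ℝ ∞ h) (N : ℕ) {x : Fin n → ℝ} (hx : x ∈ D) :
    ∑ l, pd l (fun y => ∑ Z ∈ Finset.range N, ∑ ν : Fin Z → Fin n,
        (∑ Y ∈ Finset.range (N - Z), (-1 : 𝕜) ^ Y * ∑ a : Fin Y → Fin n,
          iterPD a (q (Fin.cons l (Fin.append a ν) : Fin (Y + Z + 1) → Fin n)) y) *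
            iterPD ν h y) x =
      ∑ X ∈ Finset.range (N + 1), ∑ μ : Fin X → Fin n, iterPD μ h x * q μ x -
        (∑ X ∈ Finset.range (N + 1), (-1) ^ X * ∑ μ : Fin X → Fin n, iterPD μ (q μ) x) * h x := by
  have hqd : ∀ {Y X : ℕ} (a : Fin Y → Fin n) (μ : Fin X → Fin n),
      DifferentiableAt ℝ (iterPD a (q μ)) x := fun a μ =>
    ((contDiffOn_iterPD hD a (hq μ)).contDiffAt (hD.mem_nhds hx)).differentiableAt (by simp)
  have hhd : ∀ {Z : ℕ} (ν : Fin Z → Fin n), DifferentiableAt ℝ (iterPD ν h) x := fun ν =>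
    (contDiff_iterPD ν hh).differentiable (by simp) x
  have hq_congr : ∀ {Y X X' : ℕ} (a : Fin Y → Fin n) (e : Fin X ≃ Fin X') (μ : Fin X' → Fin n),
      iterPD a (q (μ ∘ e)) x = iterPD a (q μ) x := by
    intro Y X X' a e μ
    refine (iterPD_eventuallyEq ?_ a).self_of_nhds
    filter_upwards [hD.mem_nhds hx] with y hy
    exact hsym e μ y hy
  -- `A Y Z` contracts Y derivatives of q with Z derivatives of h. By the product rule the outer ∂_l
  -- raises either Y or Z by one, which is the pattern of `alternating_telescope`; its ends are the
  -- first variation and the Euler–Lagrange term.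
  set A : ℕ → ℕ → 𝕜 := fun Y Z => ∑ a : Fin Y → Fin n, ∑ ν : Fin Z → Fin n,
    iterPD a (q (Fin.append a ν)) x * iterPD ν h x with hA
  have hA1 : ∀ Y Z, A (Y + 1) Z = ∑ l, ∑ ν : Fin Z → Fin n, ∑ a : Fin Y → Fin n,
      pd l (iterPD a (q (Fin.cons l (Fin.append a ν) : Fin (Y + Z + 1) → Fin n))) x *
        iterPD ν h x := by
    intro Y Z
    simp only [hA]
    rw [sum_fin_cons]
    refine Finset.sum_congr rfl fun l _ => ?_
    rw [Finset.sum_comm]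
    refine Finset.sum_congr rfl fun ν _ => Finset.sum_congr rfl fun a _ => ?_
    obtain ⟨e, he⟩ := append_cons_left_equiv l a ν
    rw [he, hq_congr]
    rfl
  have hA2 : ∀ Y Z, A Y (Z + 1) = ∑ l, ∑ ν : Fin Z → Fin n, ∑ a : Fin Y → Fin n,
      iterPD a (q (Fin.cons l (Fin.append a ν) : Fin (Y + Z + 1) → Fin n)) x *
        pd l (iterPD ν h) x := by
    intro Y Z
    simp only [hA]
    rw [Finset.sum_comm, sum_fin_cons]
    refine Finset.sum_congr rfl fun l _ => Finset.sum_congr rfl fun ν _ =>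
      Finset.sum_congr rfl fun a _ => ?_
    obtain ⟨e, he⟩ := append_cons_right_equiv l a ν
    rw [he, hq_congr]
    rfl
  have hA3 : ∀ X, A 0 X = ∑ μ : Fin X → Fin n, iterPD μ h x * q μ x := by
    intro X
    simp only [hA, Fintype.sum_unique]
    refine Finset.sum_congr rfl fun μ _ => ?_
    have : Fin.append (default : Fin 0 → Fin n) μ = μ ∘ finCongr (Nat.zero_add X) := by
      rw [Subsingleton.elim (default : Fin 0 → Fin n) Fin.elim0, Fin.elim0_append]
      rfl
    rw [this, hq_congr, mul_comm]
    rfl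
  have hA4 : ∀ X, A X 0 = (∑ μ : Fin X → Fin n, iterPD μ (q μ) x) * h x := by
    intro X
    simp only [hA, Fintype.sum_unique, Finset.sum_mul]
    refine Finset.sum_congr rfl fun μ _ => ?_
    have : Fin.append μ (default : Fin 0 → Fin n) = μ := by
      rw [Subsingleton.elim (default : Fin 0 → Fin n) Fin.elim0, Fin.append_elim0]
      rfl
    rw [this]
    rfl
  have hL : ∀ l, pd l (fun y => ∑ Z ∈ Finset.range N, ∑ ν : Fin Z → Fin n,
        (∑ Y ∈ Finset.range (N - Z), (-1 : 𝕜) ^ Y * ∑ a : Fin Y → Fin n,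
          iterPD a (q (Fin.cons l (Fin.append a ν) : Fin (Y + Z + 1) → Fin n)) y) *
            iterPD ν h y) x =
      ∑ Z ∈ Finset.range N, ∑ Y ∈ Finset.range (N - Z), (-1 : 𝕜) ^ Y *
        (∑ ν : Fin Z → Fin n, ∑ a : Fin Y → Fin n,
          pd l (iterPD a (q (Fin.cons l (Fin.append a ν) : Fin (Y + Z + 1) → Fin n))) x *
            iterPD ν h x +
        ∑ ν : Fin Z → Fin n, ∑ a : Fin Y → Fin n,
          iterPD a (q (Fin.cons l (Fin.append a ν) : Fin (Y + Z + 1) → Fin n)) x *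
            pd l (iterPD ν h) x) := by
    intro l
    have hd1 : ∀ (Z : ℕ) (ν : Fin Z → Fin n) (Y : ℕ), DifferentiableAt ℝ (fun y =>
        ∑ a : Fin Y → Fin n,
          iterPD a (q (Fin.cons l (Fin.append a ν) : Fin (Y + Z + 1) → Fin n)) y) x :=
      fun Z ν Y => DifferentiableAt.fun_sum fun a _ => hqd a _
    have hd2 : ∀ (Z : ℕ) (ν : Fin Z → Fin n), DifferentiableAt ℝ (fun y =>
        ∑ Y ∈ Finset.range (N - Z), (-1 : 𝕜) ^ Y * ∑ a : Fin Y → Fin n,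
          iterPD a (q (Fin.cons l (Fin.append a ν) : Fin (Y + Z + 1) → Fin n)) y) x :=
      fun Z ν => DifferentiableAt.fun_sum fun Y _ => (hd1 Z ν Y).const_mul _
    rw [pd_sum _ fun Z _ => DifferentiableAt.fun_sum fun ν _ => (hd2 Z ν).fun_mul (hhd ν)]
    refine Finset.sum_congr rfl fun Z _ => ?_
    rw [pd_sum _ fun ν _ => (hd2 Z ν).fun_mul (hhd ν)]
    have hν : ∀ ν : Fin Z → Fin n, pd l (fun y =>
        (∑ Y ∈ Finset.range (N - Z), (-1 : 𝕜) ^ Y * ∑ a : Fin Y → Fin n,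
          iterPD a (q (Fin.cons l (Fin.append a ν) : Fin (Y + Z + 1) → Fin n)) y) *
            iterPD ν h y) x =
        ∑ Y ∈ Finset.range (N - Z), ((-1 : 𝕜) ^ Y * ∑ a : Fin Y → Fin n,
          pd l (iterPD a (q (Fin.cons l (Fin.append a ν) : Fin (Y + Z + 1) → Fin n))) x *
            iterPD ν h x + (-1 : 𝕜) ^ Y * ∑ a : Fin Y → Fin n,
          iterPD a (q (Fin.cons l (Fin.append a ν) : Fin (Y + Z + 1) → Fin n)) x *
            pd l (iterPD ν h) x) := by
      intro ν
      rw [pd_mul (hd2 Z ν) (hhd ν), pd_sum _ fun Y _ => (hd1 Z ν Y).const_mul _]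
      simp only [pd_const_mul _ (hd1 Z ν _), pd_sum _ fun a _ => hqd a _, Finset.sum_mul,
        mul_assoc, Finset.sum_add_distrib]
    rw [Finset.sum_congr rfl fun ν _ => hν ν, Finset.sum_comm]
    simp only [Finset.sum_add_distrib, mul_add, Finset.mul_sum]
  rw [Finset.sum_congr rfl fun l _ => hL l, Finset.sum_comm]
  have hstep : ∀ Z ∈ Finset.range N, ∑ l, ∑ Y ∈ Finset.range (N - Z), (-1 : 𝕜) ^ Y *
        (∑ ν : Fin Z → Fin n, ∑ a : Fin Y → Fin n,
          pd l (iterPD a (q (Fin.cons l (Fin.append a ν) : Fin (Y + Z + 1) → Fin n))) x *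
            iterPD ν h x +
        ∑ ν : Fin Z → Fin n, ∑ a : Fin Y → Fin n,
          iterPD a (q (Fin.cons l (Fin.append a ν) : Fin (Y + Z + 1) → Fin n)) x *
            pd l (iterPD ν h) x) =
      ∑ Y ∈ Finset.range (N - Z), (-1 : 𝕜) ^ Y * (A (Y + 1) Z + A Y (Z + 1)) := by
    intro Z _
    rw [Finset.sum_comm]
    refine Finset.sum_congr rfl fun Y _ => ?_
    rw [hA1, hA2, ← Finset.sum_add_distrib, Finset.mul_sum]
  rw [Finset.sum_congr rfl hstep, alternating_telescope, Finset.sum_sub_distrib, Finset.sum_mul]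
  simp only [hA3, hA4, mul_assoc]

end Momentum

/-! ### First variation of the Lagrangian along a field -/

section EulerLagrange

variable {𝕜 : Type*} [RCLike 𝕜] {n f N : ℕ}
  {L : (Fin n → ℝ) × Jet 𝕜 n f (N + 1) → 𝕜} {𝒰 : Set ((Fin n → ℝ) × Jet 𝕜 n f (N + 1))}

lemma contDiff_jet_family {Φs : ℝ → (Fin n → ℝ) → Fin f → 𝕜}
    (hΦs : ContDiff ℝ ∞ (fun p : ℝ × (Fin n → ℝ) => Φs p.1 p.2)) (k : ℕ) :
    ContDiff ℝ ∞ (fun p : ℝ × (Fin n → ℝ) => jet k (Φs p.1) p.2) :=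
  contDiff_pi.2 fun _ => contDiff_pi.2 fun μ => contDiff_pi.2 fun B =>
    contDiff_iterPD_slice (G := fun p => Φs p.1 p.2 B) (contDiff_pi.1 hΦs B) μ

lemma contDiff_jet {Φ : (Fin n → ℝ) → Fin f → 𝕜} (hΦ : ContDiff ℝ ∞ Φ) (k : ℕ) :
    ContDiff ℝ ∞ (jet k Φ) :=
  contDiff_pi.2 fun _ => contDiff_pi.2 fun μ => contDiff_pi.2 fun B =>
    contDiff_iterPD μ (contDiff_pi.1 hΦ B)

/-- The points at which the jet of `Φ` is an admissible argument. -/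
def jetDomain (𝒰 : Set ((Fin n → ℝ) × Jet 𝕜 n f (N + 1))) (Φ : (Fin n → ℝ) → Fin f → 𝕜) :
    Set (Fin n → ℝ) :=
  {y | (y, jet (N + 1) Φ y) ∈ 𝒰}

lemma contDiff_graph_jet {Φ : (Fin n → ℝ) → Fin f → 𝕜} (hΦ : ContDiff ℝ ∞ Φ) (k : ℕ) :
    ContDiff ℝ ∞ fun y => (y, jet k Φ y) :=
  contDiff_id.prodMk (contDiff_jet hΦ k)

lemma isOpen_jetDomain (hL : IsLagrangian L 𝒰) {Φ : (Fin n → ℝ) → Fin f → 𝕜}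
    (hΦ : ContDiff ℝ ∞ Φ) : IsOpen (jetDomain 𝒰 Φ) :=
  hL.isOpen.preimage (contDiff_graph_jet hΦ (N + 1)).continuous

lemma contDiffOn_partialL_jet (hL : IsLagrangian L 𝒰) {Φ : (Fin n → ℝ) → Fin f → 𝕜}
    (hΦ : ContDiff ℝ ∞ Φ) {X : ℕ} (μ : Fin X → Fin n) (B : Fin f) :
    ContDiffOn ℝ ∞ (fun y => partialL L μ B (y, jet (N + 1) Φ y)) (jetDomain 𝒰 Φ) :=
  (hL.contDiffOn_partialL μ B).comp (contDiff_graph_jet hΦ (N + 1)).contDiffOn fun _ hy => hy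

lemma contDiffOn_lagrangian_jet (hL : IsLagrangian L 𝒰) {Φ : (Fin n → ℝ) → Fin f → 𝕜}
    (hΦ : ContDiff ℝ ∞ Φ) :
    ContDiffOn ℝ ∞ (fun y => L (y, jet (N + 1) Φ y)) (jetDomain 𝒰 Φ) :=
  hL.smooth.comp (contDiff_graph_jet hΦ (N + 1)).contDiffOn fun _ hy => hy

lemma contDiffOn_momentumK (hL : IsLagrangian L 𝒰) {Φ : (Fin n → ℝ) → Fin f → 𝕜}
    (hΦ : ContDiff ℝ ∞ Φ) (l : Fin n) (Z : Fin N) (ν : Fin (Z : ℕ) → Fin n) (B : Fin f) :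
    ContDiffOn ℝ ∞ (fun y => momentumK L Φ y l Z ν B) (jetDomain 𝒰 Φ) :=
  ContDiffOn.sum fun _ _ => contDiffOn_const.mul <| ContDiffOn.sum fun μ _ =>
    contDiffOn_iterPD (isOpen_jetDomain hL hΦ) μ (contDiffOn_partialL_jet hL hΦ _ B)

/-- The Euler–Lagrange expression of the field `Φ_B`. -/
def eulerLagrange (L : (Fin n → ℝ) × Jet 𝕜 n f (N + 1) → 𝕜) (Φ : (Fin n → ℝ) → Fin f → 𝕜)
    (B : Fin f) (x : Fin n → ℝ) : 𝕜 :=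
  ∑ X ∈ Finset.range (N + 1), (-1) ^ X * ∑ μ : Fin X → Fin n,
    iterPD μ (fun y => partialL L μ B (y, jet (N + 1) Φ y)) x

lemma contDiffOn_eulerLagrange (hL : IsLagrangian L 𝒰) {Φ : (Fin n → ℝ) → Fin f → 𝕜}
    (hΦ : ContDiff ℝ ∞ Φ) (B : Fin f) :
    ContDiffOn ℝ ∞ (eulerLagrange L Φ B) (jetDomain 𝒰 Φ) :=
  ContDiffOn.sum fun _ _ => contDiffOn_const.mul <| ContDiffOn.sum fun μ _ =>
    contDiffOn_iterPD (isOpen_jetDomain hL hΦ) μ (contDiffOn_partialL_jet hL hΦ _ B)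

/-- The current `Σ K^{B l ν} ∂_ν η_B` of a variation `η`. -/
def momentumCurrent (L : (Fin n → ℝ) × Jet 𝕜 n f (N + 1) → 𝕜) (Φ η : (Fin n → ℝ) → Fin f → 𝕜)
    (l : Fin n) (y : Fin n → ℝ) : 𝕜 :=
  ∑ Z : Fin N, ∑ ν : Fin (Z : ℕ) → Fin n, ∑ B : Fin f,
    momentumK L Φ y l Z ν B * jet N η y Z ν B

lemma contDiffOn_momentumCurrent (hL : IsLagrangian L 𝒰) {Φ η : (Fin n → ℝ) → Fin f → 𝕜}
    (hΦ : ContDiff ℝ ∞ Φ) (hη : ContDiff ℝ ∞ η) (l : Fin n) :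
    ContDiffOn ℝ ∞ (momentumCurrent L Φ η l) (jetDomain 𝒰 Φ) :=
  ContDiffOn.sum fun Z _ => ContDiffOn.sum fun ν _ => ContDiffOn.sum fun B _ =>
    (contDiffOn_momentumK hL hΦ l Z ν B).mul
      (contDiff_pi.1 (contDiff_pi.1 (contDiff_pi.1 (contDiff_jet hη N) Z) ν) B).contDiffOn

/-- The first variation of the Lagrangian along `Φ`. -/
def firstVariation (L : (Fin n → ℝ) × Jet 𝕜 n f (N + 1) → 𝕜) (Φ η : (Fin n → ℝ) → Fin f → 𝕜)
    (x : Fin n → ℝ) : 𝕜 :=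
  ∑ X : Fin (N + 1), ∑ μ : Fin (X : ℕ) → Fin n, ∑ B : Fin f,
    jet (N + 1) η x X μ B * partialL L μ B (x, jet (N + 1) Φ x)

/-- Apply `sum_pd_momentum` to each field separately, with the derivatives of L along Φ in the role
of q: up to the Euler–Lagrange term, the first variation is the divergence of the momentum current.
-/
lemma firstVariation_eq (hL : IsLagrangian L 𝒰) {Φ η : (Fin n → ℝ) → Fin f → 𝕜}
    (hΦ : ContDiff ℝ ∞ Φ) (hη : ContDiff ℝ ∞ η) {x : Fin n → ℝ} (hx : x ∈ jetDomain 𝒰 Φ) :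
    firstVariation L Φ η x =
      ∑ l, pd l (momentumCurrent L Φ η l) x + ∑ B, eulerLagrange L Φ B x * η x B := by
  have hD := isOpen_jetDomain hL hΦ
  have hB : ∀ B, ∑ l, pd l (fun y => ∑ Z : Fin N, ∑ ν : Fin (Z : ℕ) → Fin n,
      momentumK L Φ y l Z ν B * jet N η y Z ν B) x =
      ∑ X : Fin (N + 1), ∑ μ : Fin (X : ℕ) → Fin n,
        jet (N + 1) η x X μ B * partialL L μ B (x, jet (N + 1) Φ x) -
      eulerLagrange L Φ B x * η x B := by
    intro B
    have h := sum_pd_momentum hD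
      (q := fun {X} (μ : Fin X → Fin n) y => partialL L μ B (y, jet (N + 1) Φ y))
      (fun μ => contDiffOn_partialL_jet hL hΦ μ B)
      (fun e μ y hy => hL.partialL_comp_equiv hy e μ B) (contDiff_pi.1 hη B) N hx
    rw [← Fin.sum_univ_eq_sum_range (fun X => ∑ μ : Fin X → Fin n,
      iterPD μ (fun y => η y B) x * partialL L μ B (x, jet (N + 1) Φ x))] at h
    refine Eq.trans (Finset.sum_congr rfl fun l _ => ?_) h
    congr 1
    funext y
    exact Fin.sum_univ_eq_sum_range (fun Z => ∑ ν : Fin Z → Fin n,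
        (∑ Y ∈ Finset.range (N - Z), (-1 : 𝕜) ^ Y * ∑ a : Fin Y → Fin n,
          iterPD a (fun y => partialL L (Fin.cons l (Fin.append a ν) : Fin (Y + Z + 1) → Fin n) B
            (y, jet (N + 1) Φ y)) y) * iterPD ν (fun y => η y B) y) N
  have hcur : ∀ l, pd l (momentumCurrent L Φ η l) x = ∑ B, pd l (fun y => ∑ Z : Fin N,
      ∑ ν : Fin (Z : ℕ) → Fin n, momentumK L Φ y l Z ν B * jet N η y Z ν B) x := by
    intro l
    rw [← pd_sum]
    · congr 1
      funext y
      simp only [momentumCurrent]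
      rw [Finset.sum_comm]
      refine Finset.sum_congr rfl fun Z _ => ?_
      rw [Finset.sum_comm]
    · intro B _
      refine ContDiffAt.differentiableAt (n := ∞) (ContDiffOn.contDiffAt (s := jetDomain 𝒰 Φ) ?_
        (hD.mem_nhds hx)) (by simp)
      exact ContDiffOn.sum fun Z _ => ContDiffOn.sum fun ν _ =>
        (contDiffOn_momentumK hL hΦ l Z ν B).mul
          (contDiff_pi.1 (contDiff_pi.1 (contDiff_pi.1 (contDiff_jet hη N) Z) ν) B).contDiffOn
  simp only [hcur]
  rw [Finset.sum_comm, ← Finset.sum_add_distrib]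
  simp only [hB, sub_add_cancel, firstVariation]
  rw [Finset.sum_comm]
  refine Finset.sum_congr rfl fun X _ => ?_
  rw [Finset.sum_comm]

/-- The variation `∂_ε Φ_ε` at `ε = 0` and a fixed point of space. -/
def fieldVariation (Φs : ℝ → (Fin n → ℝ) → Fin f → 𝕜) (x : Fin n → ℝ) (B : Fin f) : 𝕜 :=
  dParam (fun p : ℝ × (Fin n → ℝ) => Φs p.1 p.2 B) (0, x)

lemma contDiff_fieldVariation {Φs : ℝ → (Fin n → ℝ) → Fin f → 𝕜}
    (hΦs : ContDiff ℝ ∞ (fun p : ℝ × (Fin n → ℝ) => Φs p.1 p.2)) :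
    ContDiff ℝ ∞ (fieldVariation Φs) :=
  contDiff_pi.2 fun B => (contDiff_dParam (contDiff_pi.1 hΦs B)).comp
    (contDiff_const.prodMk contDiff_id)

/-- Variation and differentiation commute. -/
lemma hasDerivAt_jet_family {Φs : ℝ → (Fin n → ℝ) → Fin f → 𝕜}
    (hΦs : ContDiff ℝ ∞ (fun p : ℝ × (Fin n → ℝ) => Φs p.1 p.2)) (k : ℕ) (x : Fin n → ℝ) :
    HasDerivAt (fun ε => jet k (Φs ε) x) (jet k (fieldVariation Φs) x) 0 := by
  refine hasDerivAt_pi.2 fun X => hasDerivAt_pi.2 fun μ => hasDerivAt_pi.2 fun B => ?_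
  have hG : ContDiff ℝ ∞ (fun p : ℝ × (Fin n → ℝ) => Φs p.1 p.2 B) := contDiff_pi.1 hΦs B
  have h := hasDerivAt_slice (ε := 0) (x := x)
    ((contDiff_iterPD_slice hG μ).differentiable (by simp) (0, x))
  rw [← iterPD_dParam hG μ (0, x)] at h
  exact h

lemma dParam_lagrangian (hL : IsLagrangian L 𝒰) {Φs : ℝ → (Fin n → ℝ) → Fin f → 𝕜}
    (hΦs : ContDiff ℝ ∞ (fun p : ℝ × (Fin n → ℝ) => Φs p.1 p.2)) {x : Fin n → ℝ}
    (hx : x ∈ jetDomain 𝒰 (Φs 0)) :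
    dParam (fun p : ℝ × (Fin n → ℝ) => L (p.2, jet (N + 1) (Φs p.1) p.2)) (0, x) =
      firstVariation L (Φs 0) (fieldVariation Φs) x := by
  have hLd := (hL.contDiffAt hx).differentiableAt (by simp)
  have hj : DifferentiableAt ℝ
      (fun p : ℝ × (Fin n → ℝ) => (p.2, jet (N + 1) (Φs p.1) p.2)) (0, x) :=
    (contDiff_snd.prodMk (contDiff_jet_family hΦs (N + 1))).differentiable
      (n := ∞) (by simp) (0, x)
  have h1 := hasDerivAt_slice (ε := 0) (x := x) (DifferentiableAt.comp
    (g := L) (0, x) hLd hj)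
  have h2 := hLd.hasFDerivAt.comp_hasDerivAt (0 : ℝ)
    ((hasDerivAt_const (0 : ℝ) x).prodMk (hasDerivAt_jet_family hΦs (N + 1) x))
  have h3 := h1.unique h2
  rw [hL.fderiv_apply_jet hx] at h3
  exact h3

end EulerLagrange

/-! ### Real movements satisfy the Euler–Lagrange equations -/

section EulerLagrangeEquation

variable {𝕜 : Type*} [RCLike 𝕜] {m f N : ℕ}
  {L : (Fin (m + 1) → ℝ) × Jet 𝕜 (m + 1) f (N + 1) → 𝕜}
  {𝒰 : Set ((Fin (m + 1) → ℝ) × Jet 𝕜 (m + 1) f (N + 1))} {Ω : Set (Fin (m + 1) → ℝ)}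

lemma integrableOn_of_continuousOn {n : ℕ} {Ω D : Set (Fin n → ℝ)}
    (hΩb : Bornology.IsBounded Ω) (hΩD : closure Ω ⊆ D) {u : (Fin n → ℝ) → 𝕜}
    (hu : ContinuousOn u D) : IntegrableOn u Ω :=
  ((hu.mono hΩD).integrableOn_compact hΩb.isCompact_closure).mono_set subset_closure

/-- The fundamental lemma of the calculus of variations: for g supported in Ω, the variation g e_B
is admissible and its boundary flux vanishes, so stationarity reads ∫ g E_B = 0. Vanishing almost
everywhere is enough, since E_B is later needed only under an integral. -/
theorem IsRealMovement.eulerLagrange_ae_eq_zero (hL : IsLagrangian L 𝒰) (hΩ : IsOpen Ω)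
    (hΩb : Bornology.IsBounded Ω) (𝒜 : BoundaryAtlas m Ω)
    {Φ : (Fin (m + 1) → ℝ) → Fin f → 𝕜} (hΦ : IsRealMovement L 𝒰 Ω Φ) (B : Fin f) :
    ∀ᵐ x, x ∈ Ω → eulerLagrange L Φ B x = 0 := by
  have hD := isOpen_jetDomain hL hΦ.smooth
  have hΩD : closure Ω ⊆ jetDomain 𝒰 Φ := hΦ.mem
  have hEc := (contDiffOn_eulerLagrange hL hΦ.smooth B).continuousOn
  refine hΩ.ae_eq_zero_of_integral_contDiff_smul_eq_zero
    ((hEc.mono (subset_closure.trans hΩD)).locallyIntegrableOn hΩ.measurableSet) ?_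
  intro g hg hgc hgΩ
  set η : (Fin (m + 1) → ℝ) → Fin f → 𝕜 := fun x => g x • Pi.single B 1 with hη
  have hηs : ContDiff ℝ ∞ η := hg.smul contDiff_const
  have hη0 : ∀ x ∈ frontier Ω, ∀ k, jet k η x = 0 := by
    intro x hx k
    have hxg : x ∉ tsupport g := fun h => by
      rw [hΩ.frontier_eq] at hx
      exact hx.2 (hgΩ h)
    funext X μ B'
    have h1 : (fun y => η y B') =ᶠ[𝓝 x] 0 := by
      filter_upwards [notMem_tsupport_iff_eventuallyEq.1 hxg] with y hy
      simp [hη, hy]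
    exact (iterPD_eventuallyEq h1 μ).self_of_nhds.trans (iterPD_zero_fun μ x)
  set Φs : ℝ → (Fin (m + 1) → ℝ) → Fin f → 𝕜 := fun ε x => Φ x + ε • η x with hΦs
  have hΦs_sm : ContDiff ℝ ∞ (fun p : ℝ × (Fin (m + 1) → ℝ) => Φs p.1 p.2) :=
    (hΦ.smooth.comp contDiff_snd).add (contDiff_fst.smul (hηs.comp contDiff_snd))
  have hΦs0 : Φs 0 = Φ := by funext x; simp [hΦs]
  have hvar : fieldVariation Φs = η := by
    funext x B'
    have h1 := hasDerivAt_slice (ε := 0) (x := x)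
      ((contDiff_pi.1 hΦs_sm B').differentiable (by simp) (0, x))
    have h2 : HasDerivAt (fun ε : ℝ => Φ x B' + ε • η x B') ((1 : ℝ) • η x B') 0 :=
      ((hasDerivAt_id (0 : ℝ)).smul_const (η x B')).const_add _
    rw [one_smul] at h2
    exact h1.unique h2
  have hstat := hΦ.stationary η hηs fun x hx => hη0 x hx N
  have hO : IsOpen {p : ℝ × (Fin (m + 1) → ℝ) | (p.2, jet (N + 1) (Φs p.1) p.2) ∈ 𝒰} :=
    hL.isOpen.preimage (contDiff_snd.prodMk (contDiff_jet_family hΦs_sm (N + 1))).continuous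
  have hder := hasDerivAt_setIntegral hΩ hΩb
    (H := fun p : ℝ × (Fin (m + 1) → ℝ) => L (p.2, jet (N + 1) (Φs p.1) p.2)) hO
    (fun x hx => by
      change (x, jet (N + 1) (Φs 0) x) ∈ 𝒰
      rw [hΦs0]; exact hΦ.mem x hx)
    (hL.smooth.comp (contDiff_snd.prodMk (contDiff_jet_family hΦs_sm (N + 1))).contDiffOn
      fun p hp => hp)
  have h0 := hder.unique hstat
  have h1 : ∫ x in Ω, (∑ l, pd l (momentumCurrent L Φ η l) x +
      ∑ B', eulerLagrange L Φ B' x * η x B') = 0 := by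
    rw [← h0]
    refine setIntegral_congr_fun hΩ.measurableSet fun x hx => ?_
    have hxD : x ∈ jetDomain 𝒰 Φ := hΩD (subset_closure hx)
    have h2 := dParam_lagrangian hL hΦs_sm (x := x) (by rwa [hΦs0])
    rw [hΦs0, hvar] at h2
    exact (firstVariation_eq hL hΦ.smooth hηs hxD).symm.trans h2.symm
  have hcur := fun l => contDiffOn_momentumCurrent hL hΦ.smooth hηs l
  have hE : ∀ x, ∑ B', eulerLagrange L Φ B' x * η x B' = g x • eulerLagrange L Φ B x := by
    intro x
    rw [Finset.sum_eq_single B]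
    · simp [hη, RCLike.real_smul_eq_coe_mul, mul_comm]
    · intro B' _ hB'
      simp [hη, hB']
    · simp
  simp only [hE] at h1
  rw [integral_add, setIntegral_divergence hΩ hΩb 𝒜 hD hΩD hcur] at h1
  · have h2 : 𝒜.flux (fun x l => momentumCurrent L Φ η l x) = 0 := by
      rw [𝒜.flux_congr hΩ (V' := fun _ _ => 0)]
      · simp [BoundaryAtlas.flux]
      · intro x hx
        funext l
        simp [momentumCurrent, hη0 x hx]
    rw [h2, zero_add] at h1
    rw [← h1, setIntegral_eq_integral_of_forall_compl_eq_zero]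
    intro x hx
    have : g x = 0 := image_eq_zero_of_notMem_tsupport fun h => hx (hgΩ h)
    simp [this]
  · exact integrable_finsetSum _ fun l _ => integrableOn_of_continuousOn hΩb hΩD
      (contDiffOn_pd hD (hcur l) l).continuousOn
  · exact integrableOn_of_continuousOn hΩb hΩD (hg.continuous.continuousOn.smul hEc)

end EulerLagrangeEquation

/-! ### Deformations of the region: Jacobian, injectivity, frontier of the image -/

section Deformation

/-- In the Leibniz expansion a nontrivial permutation moves at least two indices. Differentiating
one factor still leaves an off-diagonal entry of the identity matrix, so only the trivial
permutation contributes, giving the trace. -/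
lemma hasDerivAt_det_of_eq_one {ι : Type*} [Fintype ι] [DecidableEq ι] {M : ℝ → Matrix ι ι ℝ}
    {M' : Matrix ι ι ℝ} {t : ℝ} (h0 : M t = 1)
    (hM : ∀ i j, HasDerivAt (fun ε => M ε i j) (M' i j) t) :
    HasDerivAt (fun ε => (M ε).det) M'.trace t := by
  simp only [Matrix.det_apply]
  have h1 : HasDerivAt (fun ε => ∑ σ : Equiv.Perm ι, Equiv.Perm.sign σ • ∏ i, M ε (σ i) i)
      (∑ σ : Equiv.Perm ι, Equiv.Perm.sign σ •
        ∑ i, (∏ j ∈ Finset.univ.erase i, M t (σ j) j) • M' (σ i) i) t := by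
    refine HasDerivAt.fun_sum fun σ _ => ?_
    have h2 : HasDerivAt (fun ε => ∏ i, M ε (σ i) i)
        (∑ i, (∏ j ∈ Finset.univ.erase i, M t (σ j) j) • M' (σ i) i) t :=
      HasDerivAt.fun_finsetProd fun i _ => hM (σ i) i
    simp only [Units.smul_def, zsmul_eq_mul]
    exact h2.const_mul _
  convert h1 using 1
  rw [Finset.sum_eq_single 1]
  · simp only [Equiv.Perm.sign_one, one_smul, Equiv.Perm.one_apply, h0, Matrix.trace,
      Matrix.diag_apply]
    refine Finset.sum_congr rfl fun i _ => ?_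
    rw [Finset.prod_eq_one fun j _ => Matrix.one_apply_eq j, one_smul]
  · intro σ _ hσ
    rw [Finset.sum_eq_zero, smul_zero]
    intro i _
    obtain ⟨j, hj⟩ : ∃ j, σ j ≠ j := by
      by_contra! h
      exact hσ (Equiv.ext h)
    -- If the moved index j is the differentiated one, its image σ j is another moved index.
    obtain ⟨k, hki, hk⟩ : ∃ k, k ≠ i ∧ σ k ≠ k := by
      by_cases hji : j = i
      · subst hji
        exact ⟨σ j, hj, fun h => hj (σ.injective h)⟩
      · exact ⟨j, hji, hj⟩
    rw [Finset.prod_eq_zero (Finset.mem_erase.2 ⟨hki, Finset.mem_univ k⟩), zero_smul]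
    rw [h0, Matrix.one_apply_ne hk]
  · simp

variable {n : ℕ} {ψ : ℝ → (Fin n → ℝ) → (Fin n → ℝ)}

/-- The velocity `δ[ψ_ε(x)]` of a deformation. -/
def velocity (ψ : ℝ → (Fin n → ℝ) → (Fin n → ℝ)) (i : Fin n) (x : Fin n → ℝ) : ℝ :=
  dParam (fun p : ℝ × (Fin n → ℝ) => ψ p.1 p.2 i) (0, x)

/-- The Jacobian determinant of `ψ_ε`. -/
def jacobian (ψ : ℝ → (Fin n → ℝ) → (Fin n → ℝ)) (ε : ℝ) (x : Fin n → ℝ) : ℝ :=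
  (Matrix.of fun i j => pd j (fun y => ψ ε y i) x).det

namespace IsDeformation

lemma contDiff_coord (hψ : IsDeformation ψ) (i : Fin n) :
    ContDiff ℝ ∞ fun p : ℝ × (Fin n → ℝ) => ψ p.1 p.2 i :=
  contDiff_pi.1 hψ.1 i

lemma contDiff_slice (hψ : IsDeformation ψ) (ε : ℝ) : ContDiff ℝ ∞ (ψ ε) :=
  hψ.1.comp (contDiff_const.prodMk contDiff_id)

lemma contDiff_velocity (hψ : IsDeformation ψ) (i : Fin n) : ContDiff ℝ ∞ (velocity ψ i) :=
  (contDiff_dParam (hψ.contDiff_coord i)).comp (contDiff_const.prodMk contDiff_id)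

lemma hasDerivAt_velocity (hψ : IsDeformation ψ) (x : Fin n → ℝ) :
    HasDerivAt (fun ε => ψ ε x) (fun i => velocity ψ i x) 0 :=
  hasDerivAt_pi.2 fun i => hasDerivAt_slice ((hψ.contDiff_coord i).differentiable (by simp) (0, x))

lemma contDiff_pd (hψ : IsDeformation ψ) (i j : Fin n) :
    ContDiff ℝ ∞ fun p : ℝ × (Fin n → ℝ) => pd j (fun y => ψ p.1 y i) p.2 :=
  contDiff_iterPD_slice (hψ.contDiff_coord i) (fun _ : Fin 1 => j)

lemma contDiff_jacobian (hψ : IsDeformation ψ) :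
    ContDiff ℝ ∞ fun p : ℝ × (Fin n → ℝ) => jacobian ψ p.1 p.2 := by
  simp only [jacobian, Matrix.det_apply, Units.smul_def, zsmul_eq_mul]
  exact ContDiff.sum fun σ _ => contDiff_const.mul (contDiff_prod fun i _ => hψ.contDiff_pd _ _)

lemma pd_zero (hψ : IsDeformation ψ) (x : Fin n → ℝ) :
    (Matrix.of fun i j => pd j (fun y => ψ 0 y i) x) = 1 := by
  ext i j
  have h : (fun y => ψ 0 y i) = fun y => y i := by funext y; rw [hψ.2]
  have h2 : fderiv ℝ (fun y : Fin n → ℝ => y i) x =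
      ContinuousLinearMap.proj (R := ℝ) (φ := fun _ : Fin n => ℝ) i :=
    (ContinuousLinearMap.proj (R := ℝ) (φ := fun _ : Fin n => ℝ) i).fderiv
  rw [Matrix.of_apply, h, pd, h2, Matrix.one_apply]
  simp [Pi.single_apply]

lemma jacobian_zero (hψ : IsDeformation ψ) (x : Fin n → ℝ) : jacobian ψ 0 x = 1 := by
  rw [jacobian, hψ.pd_zero, Matrix.det_one]

lemma dParam_jacobian (hψ : IsDeformation ψ) (x : Fin n → ℝ) :
    dParam (fun p : ℝ × (Fin n → ℝ) => jacobian ψ p.1 p.2) (0, x) =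
      ∑ l, pd l (velocity ψ l) x := by
  have h1 := hasDerivAt_slice (ε := 0) (x := x) (hψ.contDiff_jacobian.differentiable (by simp) _)
  refine h1.unique ?_
  refine hasDerivAt_det_of_eq_one
    (M' := Matrix.of fun i j => pd j (velocity ψ i) x) (hψ.pd_zero x) fun i j => ?_
  have h2 := hasDerivAt_slice (ε := 0) (x := x)
    ((hψ.contDiff_pd i j).differentiable (by simp) (0, x))
  have h3 := iterPD_dParam (hψ.contDiff_coord i) (fun _ : Fin 1 => j) (0, x)
  exact (congrArg (fun d => HasDerivAt (fun ε => pd j (fun y => ψ ε y i) x) d 0) h3).mpr h2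

lemma det_fderiv (hψ : IsDeformation ψ) (ε : ℝ) (x : Fin n → ℝ) :
    (fderiv ℝ (ψ ε) x).det = jacobian ψ ε x := by
  rw [ContinuousLinearMap.det, ← LinearMap.det_toMatrix', jacobian]
  congr 1
  ext i j
  have hd := (hψ.contDiff_slice ε).differentiable (by simp) x
  rw [LinearMap.toMatrix'_apply, Matrix.of_apply, pd, fderiv_apply hd]
  simp

end IsDeformation

variable {m : ℕ} {Ω : Set (Fin (m + 1) → ℝ)} {φ : ℝ → (Fin (m + 1) → ℝ) → (Fin (m + 1) → ℝ)}

/-- The norm of Dφ_ε - id is jointly continuous and zero at ε = 0, hence below 1/2 on the closed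
ball for small ε. Convexity of the ball turns this into a Lipschitz bound for φ_ε - id. -/
lemma IsDeformation.eventually_approximatesLinearOn (hφ : IsDeformation φ) (R : ℝ) :
    ∀ᶠ ε in 𝓝 (0 : ℝ), ApproximatesLinearOn (φ ε)
      (ContinuousLinearEquiv.refl ℝ (Fin (m + 1) → ℝ) : _ →L[ℝ] _) (Metric.ball 0 R) (1 / 2) := by
  have hfd : ∀ p : ℝ × (Fin (m + 1) → ℝ), fderiv ℝ (φ p.1) p.2 =
      (fderiv ℝ (fun p : ℝ × (Fin (m + 1) → ℝ) => φ p.1 p.2) p).comp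
        (ContinuousLinearMap.inr ℝ ℝ (Fin (m + 1) → ℝ)) := by
    rintro ⟨ε, x⟩
    have h1 : HasFDerivAt (fun p : ℝ × (Fin (m + 1) → ℝ) => φ p.1 p.2)
      (fderiv ℝ (fun p : ℝ × (Fin (m + 1) → ℝ) => φ p.1 p.2) (ε, x)) (ε, x) :=
      (hφ.1.differentiable (by simp) _).hasFDerivAt
    exact (h1.comp x (hasFDerivAt_prodMk_right ε x)).fderiv
  have hcont : Continuous fun p : ℝ × (Fin (m + 1) → ℝ) =>
      ‖fderiv ℝ (φ p.1) p.2 - ContinuousLinearMap.id ℝ (Fin (m + 1) → ℝ)‖ := by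
    simp only [hfd]
    exact (((hφ.1.continuous_fderiv (by simp)).clm_comp continuous_const).sub
      continuous_const).norm
  have h0 : ∀ x, fderiv ℝ (φ 0) x = ContinuousLinearMap.id ℝ (Fin (m + 1) → ℝ) := by
    intro x
    rw [show φ 0 = id from funext hφ.2, fderiv_id]
  have hev := (isCompact_closedBall (0 : Fin (m + 1) → ℝ) R).eventually_forall_of_forall_eventually
    (x₀ := (0 : ℝ)) (P := fun ε x =>
      ‖fderiv ℝ (φ ε) x - ContinuousLinearMap.id ℝ (Fin (m + 1) → ℝ)‖ < 1 / 2)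
    (fun x _ => (hcont.tendsto (0, x)).eventually_lt_const (by simp [h0]))
  filter_upwards [hev] with ε hε x hx y hy
  exact (convex_ball (0 : Fin (m + 1) → ℝ) R).norm_image_sub_le_of_norm_fderiv_le'
    (fun z _ => (hφ.contDiff_slice ε).differentiable (by simp) z)
    (fun z hz => by simpa using (hε z (Metric.ball_subset_closedBall hz)).le) hy hx

/-- A map 1/2-close to the identity on a ball containing the closure of Ω is injective and open
there. As closure Ω is compact, its image is the closure of the image, so frontiers correspond. -/
lemma IsDeformation.eventually_diffeomorphic (hφ : IsDeformation φ) (hΩ : IsOpen Ω)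
    (hΩb : Bornology.IsBounded Ω) :
    ∀ᶠ ε in 𝓝 (0 : ℝ), Set.InjOn (φ ε) Ω ∧ frontier (φ ε '' Ω) = φ ε '' frontier Ω ∧
      ∀ x ∈ Ω, 0 < jacobian φ ε x := by
  obtain ⟨R, hR⟩ := hΩb.closure.subset_ball (0 : Fin (m + 1) → ℝ)
  have hdet : ∀ᶠ ε in 𝓝 (0 : ℝ), ∀ x ∈ closure Ω, 0 < jacobian φ ε x :=
    hΩb.isCompact_closure.eventually_forall_of_forall_eventually fun x _ =>
      (hφ.contDiff_jacobian.continuous.tendsto (0, x)).eventually_const_lt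
        (by simp [hφ.jacobian_zero])
  filter_upwards [hφ.eventually_approximatesLinearOn R, hdet] with ε hε hd
  -- The inverse of the identity has norm 1, so the Lipschitz constant 1/2 is below the threshold of
  -- the inverse function theorem.
  have hc : Subsingleton (Fin (m + 1) → ℝ) ∨ (1 / 2 : NNReal) <
      ‖((ContinuousLinearEquiv.refl ℝ (Fin (m + 1) → ℝ)).symm :
        (Fin (m + 1) → ℝ) →L[ℝ] (Fin (m + 1) → ℝ))‖₊⁻¹ := by
    right
    have h1 : ‖((ContinuousLinearEquiv.refl ℝ (Fin (m + 1) → ℝ)).symm :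
        (Fin (m + 1) → ℝ) →L[ℝ] (Fin (m + 1) → ℝ))‖₊ = 1 := by
      ext
      exact ContinuousLinearMap.norm_id
    rw [h1]
    norm_num
  have hinj := hε.injOn hc
  have hopen : IsOpen (φ ε '' Ω) :=
    (hε.toOpenPartialHomeomorph _ _ hc Metric.isOpen_ball).isOpen_image_of_subset_source hΩ
      (subset_closure.trans hR)
  refine ⟨hinj.mono (subset_closure.trans hR), ?_, fun x hx => hd x (subset_closure hx)⟩
  rw [hopen.frontier_eq, hΩ.frontier_eq, (hinj.mono hR).image_sdiff,
    Set.inter_eq_right.2 subset_closure, image_closure_of_isCompact hΩb.isCompact_closure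
      (hφ.contDiff_slice ε).continuous.continuousOn]

lemma IsDeformation.setIntegral_image {F : Type*} [NormedAddCommGroup F] [NormedSpace ℝ F]
    (hφ : IsDeformation φ) (hΩ : IsOpen Ω) {ε : ℝ} (hinj : Set.InjOn (φ ε) Ω)
    (hpos : ∀ x ∈ Ω, 0 < jacobian φ ε x) (g : (Fin (m + 1) → ℝ) → F) :
    ∫ y in φ ε '' Ω, g y = ∫ x in Ω, jacobian φ ε x • g (φ ε x) := by
  rw [integral_image_eq_integral_abs_det_fderiv_smul volume hΩ.measurableSet
    (fun x _ => ((hφ.contDiff_slice ε).differentiable (by simp) x).hasFDerivAt.hasFDerivWithinAt)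
    hinj]
  refine setIntegral_congr_fun hΩ.measurableSet fun x hx => ?_
  simp only [hφ.det_fderiv, abs_of_pos (hpos x hx)]

end Deformation

/-! ### Variation of the action and existence of the functional derivatives -/

section Variation

variable {𝕜 : Type*} [RCLike 𝕜] {m f N : ℕ}
  {L : (Fin (m + 1) → ℝ) × Jet 𝕜 (m + 1) f (N + 1) → 𝕜}
  {𝒰 : Set ((Fin (m + 1) → ℝ) × Jet 𝕜 (m + 1) f (N + 1))} {Ω : Set (Fin (m + 1) → ℝ)}

/-- The current whose flux is the variation of the action. -/
def variationCurrent (L : (Fin (m + 1) → ℝ) × Jet 𝕜 (m + 1) f (N + 1) → 𝕜)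
    (ψ : ℝ → (Fin (m + 1) → ℝ) → (Fin (m + 1) → ℝ)) (Φs : ℝ → (Fin (m + 1) → ℝ) → Fin f → 𝕜)
    (l : Fin (m + 1)) (x : Fin (m + 1) → ℝ) : 𝕜 :=
  momentumCurrent L (Φs 0) (fieldVariation Φs) l x +
    velocity ψ l x • L (x, jet (N + 1) (Φs 0) x)

lemma contDiffOn_variationCurrent (hL : IsLagrangian L 𝒰)
    {ψ : ℝ → (Fin (m + 1) → ℝ) → (Fin (m + 1) → ℝ)} (hψ : IsDeformation ψ)
    {Φs : ℝ → (Fin (m + 1) → ℝ) → Fin f → 𝕜}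
    (hΦs : ContDiff ℝ ∞ (fun p : ℝ × (Fin (m + 1) → ℝ) => Φs p.1 p.2))
    (hΦ : ContDiff ℝ ∞ (Φs 0)) (l : Fin (m + 1)) :
    ContDiffOn ℝ ∞ (variationCurrent L ψ Φs l) (jetDomain 𝒰 (Φs 0)) :=
  (contDiffOn_momentumCurrent hL hΦ (contDiff_fieldVariation hΦs) l).add
    ((hψ.contDiff_velocity l).contDiffOn.smul (contDiffOn_lagrangian_jet hL hΦ))

lemma pd_smul {n : ℕ} {u : (Fin n → ℝ) → ℝ} {v : (Fin n → ℝ) → 𝕜} {x : Fin n → ℝ}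
    (hu : DifferentiableAt ℝ u x) (hv : DifferentiableAt ℝ v x) (l : Fin n) :
    pd l (fun y => u y • v y) x = pd l u x • v x + u x • pd l v x := by
  simp only [pd]
  rw [(hu.hasFDerivAt.fun_smul hv.hasFDerivAt).fderiv]
  simp [add_comm]

lemma pd_add {n : ℕ} {u v : (Fin n → ℝ) → 𝕜} {x : Fin n → ℝ}
    (hu : DifferentiableAt ℝ u x) (hv : DifferentiableAt ℝ v x) (l : Fin n) :
    pd l (fun y => u y + v y) x = pd l u x + pd l v x := by
  simp only [pd]
  rw [(hu.hasFDerivAt.fun_add hv.hasFDerivAt).fderiv]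
  simp

/-- The derivative at `ε = 0` of `G (ε, ψ_ε x)`. -/
lemma IsDeformation.hasDerivAt_comp {n : ℕ} {F : Type*} [NormedAddCommGroup F] [NormedSpace ℝ F]
    {ψ : ℝ → (Fin n → ℝ) → (Fin n → ℝ)} (hψ : IsDeformation ψ) {G : ℝ × (Fin n → ℝ) → F}
    {x : Fin n → ℝ} (hG : DifferentiableAt ℝ G (0, x)) :
    HasDerivAt (fun ε => G (ε, ψ ε x))
      (dParam G (0, x) + ∑ l, velocity ψ l x • pd l (fun y => G (0, y)) x) 0 := by
  have h1 : HasDerivAt (fun ε => (ε, ψ ε x)) ((1 : ℝ), fun i => velocity ψ i x) 0 :=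
    (hasDerivAt_id (0 : ℝ)).prodMk (hψ.hasDerivAt_velocity x)
  have hG' : HasFDerivAt G (fderiv ℝ G (0, x)) (0, ψ 0 x) := by
    rw [hψ.2]
    exact hG.hasFDerivAt
  have h2 := hG'.comp_hasDerivAt (0 : ℝ) h1
  have h3 : fderiv ℝ G (0, x) (1, fun i => velocity ψ i x) =
      dParam G (0, x) + ∑ l, velocity ψ l x • pd l (fun y => G (0, y)) x := by
    rw [← fderiv_eq_sum_pd (fun y => G (0, y)) x (fun i => velocity ψ i x)]
    have h4 : fderiv ℝ (fun y => G (0, y)) x =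
        (fderiv ℝ G (0, x)).comp (ContinuousLinearMap.inr ℝ ℝ (Fin n → ℝ)) :=
      (hG.hasFDerivAt.comp x (hasFDerivAt_prodMk_right (0 : ℝ) x)).fderiv
    rw [h4, dParam, ContinuousLinearMap.comp_apply, ← map_add]
    simp
  rw [← h3]
  exact h2

/-- Since J_0 = 1 and δJ = div v, the Jacobian and the transport of the argument together give L div
v + v · ∇L = div(v L). What remains is the first variation at a fixed point of space. -/
lemma dParam_pullback_lagrangian (hL : IsLagrangian L 𝒰)
    {ψ : ℝ → (Fin (m + 1) → ℝ) → (Fin (m + 1) → ℝ)} (hψ : IsDeformation ψ)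
    {Φs : ℝ → (Fin (m + 1) → ℝ) → Fin f → 𝕜}
    (hΦs : ContDiff ℝ ∞ (fun p : ℝ × (Fin (m + 1) → ℝ) => Φs p.1 p.2))
    (hΦ : ContDiff ℝ ∞ (Φs 0)) {x : Fin (m + 1) → ℝ} (hx : x ∈ jetDomain 𝒰 (Φs 0))
    (hH : DifferentiableAt ℝ (fun p : ℝ × (Fin (m + 1) → ℝ) => jacobian ψ p.1 p.2 •
      L (ψ p.1 p.2, jet (N + 1) (Φs p.1) (ψ p.1 p.2))) (0, x)) :
    dParam (fun p : ℝ × (Fin (m + 1) → ℝ) => jacobian ψ p.1 p.2 •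
      L (ψ p.1 p.2, jet (N + 1) (Φs p.1) (ψ p.1 p.2))) (0, x) =
      ∑ l, pd l (variationCurrent L ψ Φs l) x +
        ∑ B, eulerLagrange L (Φs 0) B x * fieldVariation Φs x B := by
  have hD := isOpen_jetDomain hL hΦ
  have hη := contDiff_fieldVariation hΦs
  have hJ := hasDerivAt_slice (ε := 0) (x := x) (hψ.contDiff_jacobian.differentiable (by simp) _)
  have hM : DifferentiableAt ℝ
      (fun p : ℝ × (Fin (m + 1) → ℝ) => L (p.2, jet (N + 1) (Φs p.1) p.2)) (0, x) :=
    DifferentiableAt.comp (g := L) (0, x) ((hL.contDiffAt hx).differentiableAt (by simp))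
      ((contDiff_snd.prodMk (contDiff_jet_family hΦs (N + 1))).differentiable
        (n := ∞) (by simp) (0, x))
  have h1 := hJ.smul (hψ.hasDerivAt_comp hM)
  have h2 := (hasDerivAt_slice (ε := 0) (x := x) hH).unique h1
  have hℓ : DifferentiableAt ℝ (fun y => L (y, jet (N + 1) (Φs 0) y)) x :=
    ((contDiffOn_lagrangian_jet hL hΦ).contDiffAt (hD.mem_nhds hx)).differentiableAt (by simp)
  have hcur : ∀ l, pd l (variationCurrent L ψ Φs l) x =
      pd l (momentumCurrent L (Φs 0) (fieldVariation Φs) l) x +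
        (pd l (velocity ψ l) x • L (x, jet (N + 1) (Φs 0) x) +
          velocity ψ l x • pd l (fun y => L (y, jet (N + 1) (Φs 0) y)) x) := by
    intro l
    have hv := (hψ.contDiff_velocity l).differentiable (by simp) x
    rw [← pd_smul hv hℓ, ← pd_add _ (hv.fun_smul hℓ)]
    · rfl
    · exact ((contDiffOn_momentumCurrent hL hΦ hη l).contDiffAt
        (hD.mem_nhds hx)).differentiableAt (by simp)
  rw [h2, dParam_lagrangian hL hΦs hx, firstVariation_eq hL hΦ hη hx, hψ.dParam_jacobian]
  simp only [hcur, Finset.sum_add_distrib, hψ.jacobian_zero, one_smul, hψ.2, ← Finset.sum_smul]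
  ring

/-- The variation of the action of a family of fields over a family of regions. -/
theorem hasDerivAt_action (hL : IsLagrangian L 𝒰) (hΩ : IsOpen Ω)
    (hΩb : Bornology.IsBounded Ω) (𝒜 : BoundaryAtlas m Ω)
    {ψ : ℝ → (Fin (m + 1) → ℝ) → (Fin (m + 1) → ℝ)} (hψ : IsDeformation ψ)
    {Φs : ℝ → (Fin (m + 1) → ℝ) → Fin f → 𝕜}
    (hΦs : ContDiff ℝ ∞ (fun p : ℝ × (Fin (m + 1) → ℝ) => Φs p.1 p.2))
    (hΦ : IsRealMovement L 𝒰 Ω (Φs 0)) :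
    HasDerivAt (fun ε => action L (ψ ε '' Ω) (Φs ε))
      (𝒜.flux fun x l => variationCurrent L ψ Φs l x) 0 := by
  have hD := isOpen_jetDomain hL hΦ.smooth
  have hΩD : closure Ω ⊆ jetDomain 𝒰 (Φs 0) := hΦ.mem
  have hcur := fun l => contDiffOn_variationCurrent hL hψ hΦs hΦ.smooth l
  set arg : ℝ × (Fin (m + 1) → ℝ) → (Fin (m + 1) → ℝ) × Jet 𝕜 (m + 1) f (N + 1) :=
    fun p => (ψ p.1 p.2, jet (N + 1) (Φs p.1) (ψ p.1 p.2)) with harg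
  have harg_sm : ContDiff ℝ ∞ arg :=
    hψ.1.prodMk ((contDiff_jet_family hΦs (N + 1)).comp (contDiff_fst.prodMk hψ.1))
  set H : ℝ × (Fin (m + 1) → ℝ) → 𝕜 := fun p => jacobian ψ p.1 p.2 • L (arg p) with hH
  have hO : IsOpen (arg ⁻¹' 𝒰) := hL.isOpen.preimage harg_sm.continuous
  have hΩO : ∀ x ∈ closure Ω, ((0 : ℝ), x) ∈ arg ⁻¹' 𝒰 := by
    intro x hx
    change (ψ 0 x, jet (N + 1) (Φs 0) (ψ 0 x)) ∈ 𝒰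
    rw [hψ.2]
    exact hΦ.mem x hx
  have hH_sm : ContDiffOn ℝ ∞ H (arg ⁻¹' 𝒰) :=
    hψ.contDiff_jacobian.contDiffOn.smul (hL.smooth.comp harg_sm.contDiffOn fun _ hp => hp)
  have hder := hasDerivAt_setIntegral hΩ hΩb hO hΩO hH_sm
  have hval : ∫ x in Ω, dParam H (0, x) = 𝒜.flux fun x l => variationCurrent L ψ Φs l x := by
    rw [← setIntegral_divergence hΩ hΩb 𝒜 hD hΩD hcur]
    have hEL := ae_all_iff.2 fun B => hΦ.eulerLagrange_ae_eq_zero hL hΩ hΩb 𝒜 B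
    refine setIntegral_congr_ae hΩ.measurableSet ?_
    filter_upwards [hEL] with x hx hxΩ
    rw [dParam_pullback_lagrangian hL hψ hΦs hΦ.smooth (hΩD (subset_closure hxΩ))
      ((hH_sm.contDiffAt (hO.mem_nhds (hΩO x (subset_closure hxΩ)))).differentiableAt (by simp))]
    simp [hx _ hxΩ]
  rw [hval] at hder
  -- The change of variables is valid only for small ε, where ψ_ε is injective on Ω with positive
  -- Jacobian.
  refine hder.congr_of_eventuallyEq ?_
  filter_upwards [hψ.eventually_diffeomorphic hΩ hΩb] with ε hε
  exact hψ.setIntegral_image hΩ hε.1 hε.2.2 _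

lemma energyMomentum_continuousOn (hL : IsLagrangian L 𝒰) {Φ : (Fin (m + 1) → ℝ) → Fin f → 𝕜}
    (hΦ : ContDiff ℝ ∞ Φ) : ContinuousOn (energyMomentum L Φ) (jetDomain 𝒰 Φ) := by
  refine continuousOn_pi.2 fun l => continuousOn_pi.2 fun σ => ContinuousOn.sub ?_ ?_
  · by_cases h : l = σ
    · simp only [h, if_true]
      exact (contDiffOn_lagrangian_jet hL hΦ).continuousOn
    · simp only [h, if_false]
      exact continuousOn_const
  · refine continuousOn_finsetSum _ fun Z _ => continuousOn_finsetSum _ fun ν _ =>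
      continuousOn_finsetSum _ fun B _ => ContinuousOn.mul ?_
        (contDiffOn_momentumK hL hΦ l Z ν B).continuousOn
    exact (contDiffOn_pd isOpen_univ (contDiff_pi.1 (contDiff_pi.1 (contDiff_pi.1
      (contDiff_jet hΦ N) Z) ν) B).contDiffOn σ).continuousOn.mono (Set.subset_univ _)

lemma momentumK_continuousOn (hL : IsLagrangian L 𝒰) {Φ : (Fin (m + 1) → ℝ) → Fin f → 𝕜}
    (hΦ : ContDiff ℝ ∞ Φ) : ContinuousOn (momentumK L Φ) (jetDomain 𝒰 Φ) :=
  continuousOn_pi.2 fun l => continuousOn_pi.2 fun Z => continuousOn_pi.2 fun ν =>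
    continuousOn_pi.2 fun B => (contDiffOn_momentumK hL hΦ l Z ν B).continuousOn

/-- The variation current in terms of the variations of the hypersurface and of the boundary
data on it. -/
lemma variationCurrent_eq {ψ : ℝ → (Fin (m + 1) → ℝ) → (Fin (m + 1) → ℝ)} (hψ : IsDeformation ψ)
    {Φs : ℝ → (Fin (m + 1) → ℝ) → Fin f → 𝕜}
    (hΦs : ContDiff ℝ ∞ (fun p : ℝ × (Fin (m + 1) → ℝ) => Φs p.1 p.2))
    (x : Fin (m + 1) → ℝ) (l : Fin (m + 1)) :
    (∑ μ, energyMomentum L (Φs 0) x l μ * ((deriv (fun ε : ℝ => ψ ε x μ) 0 : ℝ) : 𝕜)) +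
      ∑ k : Fin N, ∑ ν : Fin (k : ℕ) → Fin (m + 1), ∑ B : Fin f,
        momentumK L (Φs 0) x l k ν B * deriv (fun ε : ℝ => jet N (Φs ε) (ψ ε x) k ν B) 0 =
      variationCurrent L ψ Φs l x := by
  have hv : ∀ μ, deriv (fun ε : ℝ => ψ ε x μ) 0 = velocity ψ μ x := fun μ =>
    (hasDerivAt_pi.1 (hψ.hasDerivAt_velocity x) μ).deriv
  -- Following the moving boundary point adds the transport term v^μ ∂_μ to the variation at a fixed
  -- point.
  have hj : ∀ (k : Fin N) (ν : Fin (k : ℕ) → Fin (m + 1)) (B : Fin f),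
      deriv (fun ε : ℝ => jet N (Φs ε) (ψ ε x) k ν B) 0 =
        jet N (fieldVariation Φs) x k ν B +
          ∑ μ, (velocity ψ μ x : 𝕜) * pd μ (fun y => jet N (Φs 0) y k ν B) x := by
    intro k ν B
    have hG : ContDiff ℝ ∞ fun p : ℝ × (Fin (m + 1) → ℝ) => jet N (Φs p.1) p.2 k ν B :=
      contDiff_pi.1 (contDiff_pi.1 (contDiff_pi.1 (contDiff_jet_family hΦs N) k) ν) B
    have h1 := (hψ.hasDerivAt_comp (hG.differentiable (by simp) (0, x))).deriv
    have h2 := (hasDerivAt_slice (hG.differentiable (by simp) (0, x))).unique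
      (hasDerivAt_pi.1 (hasDerivAt_pi.1 (hasDerivAt_pi.1 (hasDerivAt_jet_family hΦs N x) k) ν) B)
    rw [h2] at h1
    simpa only [RCLike.real_smul_eq_coe_mul] using h1
  simp only [hv, hj, variationCurrent, momentumCurrent, energyMomentum, sub_mul, mul_add,
    Finset.sum_add_distrib, Finset.sum_sub_distrib, ite_mul, zero_mul, Finset.sum_ite_eq,
    Finset.mem_univ, if_true, RCLike.real_smul_eq_coe_mul, Finset.mul_sum, Finset.sum_mul]
  rw [Finset.sum_comm]
  -- These transport terms cancel the sum subtracted in τ, leaving v L and the momentum current.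
  have hswap : ∑ k : Fin N, ∑ μ, ∑ ν : Fin (k : ℕ) → Fin (m + 1), ∑ B : Fin f,
      pd μ (fun y => jet N (Φs 0) y k ν B) x * momentumK L (Φs 0) x l k ν B *
        (velocity ψ μ x : 𝕜) =
      ∑ k : Fin N, ∑ ν : Fin (k : ℕ) → Fin (m + 1), ∑ B : Fin f, ∑ μ,
        momentumK L (Φs 0) x l k ν B *
          ((velocity ψ μ x : 𝕜) * pd μ (fun y => jet N (Φs 0) y k ν B) x) := by
    refine Finset.sum_congr rfl fun k _ => ?_
    rw [Finset.sum_comm]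
    refine Finset.sum_congr rfl fun ν _ => ?_
    rw [Finset.sum_comm]
    refine Finset.sum_congr rfl fun B _ => Finset.sum_congr rfl fun μ _ => ?_
    ring
  rw [hswap]
  ring

theorem isFunctionalDerivative_principal (hL : IsLagrangian L 𝒰)
    {𝓕 : Set (Set (Fin (m + 1) → ℝ) × ((Fin (m + 1) → ℝ) → Fin f → 𝕜))}
    {S : BoundaryFunctional 𝕜 (m + 1) f N} (hS : IsPrincipalFunctional L 𝒰 𝓕 S)
    (hΩ : IsOpen Ω) (hΩb : Bornology.IsBounded Ω) (𝒜 : BoundaryAtlas m Ω)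
    {Φ : (Fin (m + 1) → ℝ) → Fin f → 𝕜} (hΦ : (Ω, Φ) ∈ 𝓕) :
    IsFunctionalDerivative 𝒜 S (realVariations N 𝓕 Ω Φ)
      (energyMomentum L Φ) (momentumK L Φ) := by
  have hreal : IsRealMovement L 𝒰 Ω Φ := (hS _ hΦ).1
  have hΩD : frontier Ω ⊆ jetDomain 𝒰 Φ := fun x hx => hreal.mem x (frontier_subset_closure hx)
  refine ⟨(energyMomentum_continuousOn hL hreal.smooth).mono hΩD,
    (momentumK_continuousOn hL hreal.smooth).mono hΩD, ?_⟩
  rintro ⟨ψ, Ψ⟩ ⟨hψ, Φs, hΦs, rfl, hmem, hjet⟩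
  obtain rfl : Ψ = fun ε x => jet N (Φs ε) x := funext fun ε => funext fun x => hjet ε x
  have h1 := hasDerivAt_action hL hΩ hΩb 𝒜 hψ hΦs hreal
  simp only [variationCurrent_eq hψ hΦs]
  refine h1.congr_of_eventuallyEq ?_
  filter_upwards [hmem, hψ.eventually_diffeomorphic hΩ hΩb] with ε hε hd
  -- The data are functions on the hypersurface, so their type depends on it. Exchanging ψ_ε(∂Ω) for
  -- ∂(ψ_ε(Ω)) therefore needs a substitution rather than a rewrite.
  have hcongr : ∀ {A A' : Set (Fin (m + 1) → ℝ)}, A = A' →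
      S A (fun x => jet N (Φs ε) x) = S A' (fun x => jet N (Φs ε) x) := by
    rintro _ _ rfl
    rfl
  exact (hcongr hd.2.1.symm).trans (hS _ hε).2

end Variation

/-! ### The normal component of the hypersurface derivative is determined -/

section Uniqueness

variable {m : ℕ} {Ω : Set (Fin (m + 1) → ℝ)}

/-- If `a'` is nonpositive on the open half space on which `a` is negative, then `a'` is a positive
multiple of `a`. -/
lemma exists_pos_smul_of_dotProduct {ι : Type*} [Fintype ι] {a a' : ι → ℝ} (ha : a ≠ 0)
    (ha' : a' ≠ 0) (h : ∀ w, a ⬝ᵥ w < 0 → a' ⬝ᵥ w ≤ 0) : ∃ c : ℝ, 0 < c ∧ a' = c • a := by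
  have hq : 0 < a ⬝ᵥ a := lt_of_le_of_ne (Finset.sum_nonneg fun i _ => mul_self_nonneg _)
    fun h0 => ha (dotProduct_self_eq_zero.1 h0.symm)
  have hr : 0 ≤ a' ⬝ᵥ a := by
    have := h (-a) (by rw [dotProduct_neg]; linarith)
    rw [dotProduct_neg] at this
    linarith
  set c : ℝ := (a' ⬝ᵥ a) / (a ⬝ᵥ a) with hc
  set b : ι → ℝ := a' - c • a with hb
  have hab : a ⬝ᵥ b = 0 := by
    rw [hb, dotProduct_sub, dotProduct_smul, hc, dotProduct_comm a a']
    rw [smul_eq_mul, div_mul_cancel₀ _ hq.ne', sub_self]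
  have hbb : b ⬝ᵥ b = a' ⬝ᵥ b := by
    nth_rewrite 1 [hb]
    rw [sub_dotProduct, smul_dotProduct, hab, smul_zero, sub_zero]
  -- `b` is the part of a' orthogonal to a. The vector b - δ a lies in the open half space for every
  -- δ > 0; letting δ tend to 0 forces b = 0.
  have hle : ∀ δ : ℝ, 0 < δ → b ⬝ᵥ b ≤ δ * (a' ⬝ᵥ a) := by
    intro δ hδ
    have h1 := h (b - δ • a) (by
      rw [dotProduct_sub, dotProduct_smul, hab, smul_eq_mul]
      nlinarith)
    rw [dotProduct_sub, dotProduct_smul, smul_eq_mul, ← hbb] at h1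
    linarith
  have hb0 : b ⬝ᵥ b ≤ 0 := by
    refine le_of_forall_pos_le_add fun ε hε => ?_
    have h1 := hle (ε / (a' ⬝ᵥ a + 1)) (by positivity)
    have h2 : ε / (a' ⬝ᵥ a + 1) * (a' ⬝ᵥ a) ≤ ε := by
      rw [div_mul_eq_mul_div, div_le_iff₀ (by linarith)]
      nlinarith
    linarith
  have hbz : b = 0 := dotProduct_self_eq_zero.1
    (le_antisymm hb0 (Finset.sum_nonneg fun i _ => mul_self_nonneg _))
  have heq : a' = c • a := sub_eq_zero.1 hbz
  refine ⟨c, lt_of_le_of_ne (div_nonneg hr hq.le) fun h0 => ha' ?_, heq⟩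
  rw [heq, ← h0, zero_smul]

namespace GraphPatch

variable (P : GraphPatch m Ω)

lemma conormal_ne_zero (θ : Fin m → ℝ) : P.conormal θ ≠ 0 := by
  intro h
  have h1 := congrFun h P.i
  have h2 := P.s_mul_self
  simp only [conormal, Fin.insertNth_apply_same, Pi.zero_apply] at h1
  rw [h1] at h2
  norm_num at h2

/-- The local defining function of `Ω`. -/
def height (x : Fin (m + 1) → ℝ) : ℝ := P.s * (x P.i - P.g (P.i.removeNth x))

lemma mem_iff_height {x : Fin (m + 1) → ℝ} (hx : x ∈ P.W) : x ∈ Ω ↔ P.height x < 0 := by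
  rw [P.mem_iff x hx, height, mul_sub, sub_neg]

lemma height_point (θ : Fin m → ℝ) : P.height (P.point θ) = 0 := by
  simp [height, point_same, removeNth_point]

lemma continuous_removeNth : Continuous fun x : Fin (m + 1) → ℝ => (P.i.removeNth x : Fin m → ℝ) :=
  continuous_pi fun _ => continuous_apply _

lemma continuous_height : Continuous P.height :=
  continuous_const.mul ((continuous_apply _).sub
    (P.smooth_g.continuous.comp P.continuous_removeNth))

/-- The height vanishes at a frontier point in `W`: if negative, the point would lie in the open set
Ω; if positive, a whole neighbourhood would miss Ω. -/
lemma point_removeNth_of_mem_frontier (hΩ : IsOpen Ω) {x : Fin (m + 1) → ℝ} (hx : x ∈ frontier Ω)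
    (hxW : x ∈ P.W) : P.point (P.i.removeNth x) = x := by
  rw [hΩ.frontier_eq] at hx
  have h1 : 0 ≤ P.height x := not_lt.1 fun h => hx.2 ((P.mem_iff_height hxW).2 h)
  have h2 : P.height x ≤ 0 := by
    by_contra! h
    have hev : ∀ᶠ y in 𝓝 x, y ∉ Ω := by
      filter_upwards [P.isOpen_W.mem_nhds hxW,
        (P.continuous_height.tendsto x).eventually_const_lt h] with y hy hy'
      rw [P.mem_iff_height hy]
      exact not_lt.2 hy'.le
    exact (mem_closure_iff_frequently.1 hx.1) hev
  have h3 : x P.i = P.g (P.i.removeNth x) := by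
    have h4 : P.s * (x P.i - P.g (P.i.removeNth x)) = 0 := le_antisymm h2 h1
    have hs : P.s ≠ 0 := fun h0 => by
      have := P.s_mul_self
      rw [h0] at this
      norm_num at this
    rcases mul_eq_zero.1 h4 with h5 | h5
    · exact absurd h5 hs
    · linarith
  rw [point, ← h3, Fin.insertNth_self_removeNth]

/-- The conormal is the gradient of the height, so its pairing with a direction tells to first order
on which side of the boundary the direction leads. -/
lemma hasDerivAt_height (θ : Fin m → ℝ) (w : Fin (m + 1) → ℝ) :
    HasDerivAt (fun t : ℝ => P.height (P.point θ + t • w)) (P.conormal θ ⬝ᵥ w) 0 := by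
  have h1 : HasDerivAt (fun t : ℝ => θ + t • (P.i.removeNth w : Fin m → ℝ))
      (P.i.removeNth w : Fin m → ℝ) 0 := by
    simpa using ((hasDerivAt_id (0 : ℝ)).smul_const (P.i.removeNth w : Fin m → ℝ)).const_add θ
  have hg : HasFDerivAt P.g (fderiv ℝ P.g θ) (θ + (0 : ℝ) • (P.i.removeNth w : Fin m → ℝ)) := by
    rw [zero_smul, add_zero]
    exact (P.smooth_g.differentiable (by simp) θ).hasFDerivAt
  have h2 := hg.comp_hasDerivAt (0 : ℝ) h1
  have h3 : HasDerivAt (fun t : ℝ => P.point θ P.i + t * w P.i) (w P.i) 0 := by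
    simpa using ((hasDerivAt_id (0 : ℝ)).mul_const (w P.i)).const_add (P.point θ P.i)
  have h4 := (h3.sub h2).const_mul P.s
  have hval : P.s * (w P.i - fderiv ℝ P.g θ (P.i.removeNth w)) = P.conormal θ ⬝ᵥ w := by
    rw [fderiv_eq_sum_pd, dotProduct, Fin.sum_univ_succAbove _ P.i, mul_sub, Finset.mul_sum,
      sub_eq_add_neg, ← Finset.sum_neg_distrib]
    simp only [conormal, Fin.insertNth_apply_same, Fin.insertNth_apply_succAbove, Fin.removeNth,
      smul_eq_mul]
    congr 1
    refine Finset.sum_congr rfl fun j _ => ?_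
    ring
  rw [← hval]
  refine h4.congr_of_eventuallyEq (Filter.Eventually.of_forall fun t => ?_)
  have h5 : P.i.removeNth (P.point θ + t • w) = θ + t • (P.i.removeNth w : Fin m → ℝ) := by
    funext j
    have := congrFun (P.removeNth_point θ) j
    simp only [Fin.removeNth] at this
    simp [Fin.removeNth, this]
  simp [height, h5]

/-- Two patches induce the same orientation of the boundary. -/
lemma exists_conormal_eq_smul (P P' : GraphPatch m Ω) {θ θ' : Fin m → ℝ}
    (h : P'.point θ' = P.point θ) (hW : P.point θ ∈ P.W) (hW' : P.point θ ∈ P'.W) :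
    ∃ c : ℝ, 0 < c ∧ P'.conormal θ' = c • P.conormal θ := by
  refine exists_pos_smul_of_dotProduct (P.conormal_ne_zero θ) (P'.conormal_ne_zero θ')
    fun w hw => ?_
  have h1 := (P.hasDerivAt_height θ w).tendsto_slope_zero_right
  have h2 := (P'.hasDerivAt_height θ' w).tendsto_slope_zero_right
  simp only [zero_add, zero_smul, add_zero, height_point, sub_zero] at h1 h2
  have hline : Filter.Tendsto (fun t : ℝ => P.point θ + t • w) (𝓝[>] 0) (𝓝 (P.point θ)) := by
    have hc : Continuous fun t : ℝ => P.point θ + t • w := by fun_prop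
    simpa using (hc.tendsto 0).mono_left (nhdsWithin_le_nhds (s := Set.Ioi 0))
  -- A direction along which the height of `P` decreases leads into Ω for small t > 0. There the
  -- height of `P'` is negative as well, so its slope at 0 is at most 0.
  refine le_of_tendsto h2 ?_
  filter_upwards [h1.eventually_lt_const hw, hline.eventually (P.isOpen_W.mem_nhds hW),
    hline.eventually (P'.isOpen_W.mem_nhds hW'), self_mem_nhdsWithin] with t ht htW htW' ht0
  have ht0' : (0 : ℝ) < t := ht0
  have h3 : P.height (P.point θ + t • w) < 0 := by
    by_contra! h0
    exact absurd ht (not_lt.2 (mul_nonneg (inv_nonneg.2 ht0'.le) h0))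
  have h4 := (P'.mem_iff_height htW').1 ((P.mem_iff_height htW).2 h3)
  rw [← h] at h4
  exact mul_nonpos_of_nonneg_of_nonpos (inv_nonneg.2 ht0'.le) h4.le

end GraphPatch

variable {𝕜 : Type*} [RCLike 𝕜]

/-- A field all of whose localisations have vanishing flux has no normal component. -/
lemma BoundaryAtlas.conormal_sum_eq_zero (hΩ : IsOpen Ω) (𝒜 : BoundaryAtlas m Ω)
    {U : (Fin (m + 1) → ℝ) → Fin (m + 1) → 𝕜} (hU : ContinuousOn U (frontier Ω))
    (hflux : ∀ h : (Fin (m + 1) → ℝ) → ℝ, ContDiff ℝ ∞ h →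
      𝒜.flux (fun x l => h x • U x l) = 0)
    (k : Fin 𝒜.r) (θ : Fin m → ℝ) (hθ : (𝒜.patch k).point θ ∈ (𝒜.patch k).W) :
    ∑ l, (𝒜.patch k).conormal θ l • U ((𝒜.patch k).point θ) l = 0 := by
  by_contra hne
  set z := ∑ l, (𝒜.patch k).conormal θ l • U ((𝒜.patch k).point θ) l with hz
  set x₀ := (𝒜.patch k).point θ with hx₀
  have hx₀f : x₀ ∈ frontier Ω := (𝒜.patch k).point_mem_frontier hΩ hθ
  -- Pairing with the conjugate of z and taking real parts reduces the `𝕜`-valued question to one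
  -- about signs, with Λ z = |z|² > 0.
  set Λ : 𝕜 →L[ℝ] ℝ :=
    (RCLike.reCLM (K := 𝕜)).comp (ContinuousLinearMap.mul ℝ 𝕜 (star z)) with hΛ
  have hΛz : 0 < Λ z := by
    have h1 : Λ z = ‖z‖ ^ 2 := by
      simp only [hΛ, ContinuousLinearMap.comp_apply, ContinuousLinearMap.mul_apply',
        RCLike.reCLM_apply, RCLike.star_def, RCLike.conj_mul]
      norm_cast
    rw [h1]
    have := norm_pos_iff.2 hne
    positivity
  -- `Q` is the real flux density in patch k', written as a function of the ambient point so that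
  -- all patches can be compared at x₀.
  set Q : Fin 𝒜.r → (Fin (m + 1) → ℝ) → ℝ := fun k' x =>
    Λ (∑ l, (𝒜.patch k').conormal ((𝒜.patch k').i.removeNth x) l • U x l) with hQ
  have hQcont : ∀ k', ContinuousWithinAt (Q k') (frontier Ω) x₀ := by
    intro k'
    refine Λ.continuous.continuousAt.comp_continuousWithinAt ?_
    refine tendsto_finsetSum _ fun l _ => Filter.Tendsto.smul ?_ ?_
    · exact (((continuous_apply l).comp ((𝒜.patch k').continuous_conormal.comp
        (𝒜.patch k').continuous_removeNth)).tendsto x₀).mono_left nhdsWithin_le_nhds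
    · exact (continuousWithinAt_pi.1 (hU x₀ hx₀f)) l
  have hQpos : ∀ k', x₀ ∈ (𝒜.patch k').W → 0 < Q k' x₀ := by
    intro k' hk'
    obtain ⟨c, hc, hcon⟩ := (𝒜.patch k).exists_conormal_eq_smul (𝒜.patch k')
      ((𝒜.patch k').point_removeNth_of_mem_frontier hΩ hx₀f hk') hθ hk'
    have h1 : Q k' x₀ = c * Λ z := by
      rw [← hx₀] at hcon
      simp only [hQ, hcon, hz, Pi.smul_apply, smul_eq_mul, mul_smul]
      rw [← Finset.smul_sum, map_smul, smul_eq_mul]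
    rw [h1]
    exact mul_pos hc hΛz
  have hev : ∀ k', ∀ᶠ x in 𝓝 x₀, x ∈ frontier Ω → 0 ≤ 𝒜.χ k' x * Q k' x := by
    intro k'
    by_cases hk' : x₀ ∈ tsupport (𝒜.χ k')
    · have h1 := (hQcont k').eventually_const_lt (hQpos k' (𝒜.support_χ k' hk'))
      filter_upwards [eventually_nhdsWithin_iff.1 h1] with x hx hxf
      exact mul_nonneg (𝒜.nonneg_χ k' x) (hx hxf).le
    · filter_upwards [notMem_tsupport_iff_eventuallyEq.1 hk'] with x hx _
      simp [hx]
  -- The bump h lives where every patch has nonnegative weighted density on the frontier. The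
  -- localised flux is then a sum of nonnegative integrals, so its vanishing makes each of them
  -- zero.
  obtain ⟨h, hhs, -, hh, hrange, hh1⟩ := exists_contDiff_tsupport_subset (n := ⊤)
    (Filter.eventually_all.2 hev)
  have hh0 : ∀ x, 0 ≤ h x := fun x => (hrange ⟨x, rfl⟩).1
  set V : (Fin (m + 1) → ℝ) → Fin (m + 1) → 𝕜 := fun x l => h x • U x l with hV
  have hVc : ContinuousOn V (frontier Ω) :=
    continuousOn_pi.2 fun l => hh.continuous.continuousOn.smul (continuousOn_pi.1 hU l)
  set I : Fin 𝒜.r → (Fin m → ℝ) → ℝ := fun k' ϑ => Λ (𝒜.χ k' ((𝒜.patch k').point ϑ) •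
    ∑ l, (𝒜.patch k').conormal ϑ l • V ((𝒜.patch k').point ϑ) l) with hI
  have hIeq : ∀ k' ϑ, I k' ϑ = h ((𝒜.patch k').point ϑ) *
      (𝒜.χ k' ((𝒜.patch k').point ϑ) * Q k' ((𝒜.patch k').point ϑ)) := by
    intro k' ϑ
    simp only [hI, hQ, hV, (𝒜.patch k').removeNth_point, smul_comm _ (h _), ← Finset.smul_sum,
      map_smul, smul_eq_mul]
  have hInonneg : ∀ k' ϑ, 0 ≤ I k' ϑ := by
    intro k' ϑ
    rw [hIeq]
    by_cases hx : (𝒜.patch k').point ϑ ∈ tsupport h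
    · by_cases hχ : 𝒜.χ k' ((𝒜.patch k').point ϑ) = 0
      · simp [hχ]
      · exact mul_nonneg (hh0 _) (hhs hx k' (𝒜.point_mem_frontier_of_χ hΩ hχ))
    · simp [image_eq_zero_of_notMem_tsupport hx]
  have hIcont : ∀ k', Continuous (I k') := fun k' =>
    Λ.continuous.comp (𝒜.continuous_fluxIntegrand hΩ k' hVc)
  have hIcomp : ∀ k', HasCompactSupport (I k') := fun k' =>
    (𝒜.hasCompactSupport_χ_point k' fun ϑ => ∑ l, (𝒜.patch k').conormal ϑ l •
      V ((𝒜.patch k').point ϑ) l).comp_left (map_zero Λ)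
  have hsum : ∑ k', ∫ ϑ, I k' ϑ = 0 := by
    have h1 := congrArg Λ (hflux h hh)
    rw [map_zero, BoundaryAtlas.flux, map_sum] at h1
    rw [← h1]
    exact Finset.sum_congr rfl fun k' _ =>
      Λ.integral_comp_comm (𝒜.integrable_fluxIntegrand hΩ k' hVc)
  -- The cutoff of the given patch `k` may vanish at x₀, but the partition of unity supplies some
  -- patch with nonzero weight there. Its integral is strictly positive, a contradiction.
  obtain ⟨k', hk'⟩ : ∃ k', 𝒜.χ k' x₀ ≠ 0 := by
    by_contra! h0
    have h1 := (eventually_nhdsSet_iff_forall.1 𝒜.sum_χ x₀ hx₀f).self_of_nhds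
    simp [h0] at h1
  have hk'W : x₀ ∈ (𝒜.patch k').W := 𝒜.support_χ k' (subset_tsupport _ hk')
  have hpos : 0 < ∫ ϑ, I k' ϑ := by
    refine (hIcont k').integral_pos_of_hasCompactSupport_nonneg_nonzero (hIcomp k')
      (hInonneg k') (x := (𝒜.patch k').i.removeNth x₀) ?_
    rw [hIeq, (𝒜.patch k').point_removeNth_of_mem_frontier hΩ hx₀f hk'W, hh1, one_mul]
    exact mul_ne_zero hk' (hQpos k' hk'W).ne'
  have h0 := (Finset.sum_eq_zero_iff_of_nonneg
    (fun k'' _ => integral_nonneg (hInonneg k''))).1 hsum k' (Finset.mem_univ _)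
  exact hpos.ne' h0

variable {f N : ℕ}
  {L : (Fin (m + 1) → ℝ) × Jet 𝕜 (m + 1) f (N + 1) → 𝕜}
  {𝒰 : Set ((Fin (m + 1) → ℝ) × Jet 𝕜 (m + 1) f (N + 1))}

lemma isDeformation_add_smul {n : ℕ} {h : (Fin n → ℝ) → ℝ} (hh : ContDiff ℝ ∞ h)
    (e : Fin n → ℝ) : IsDeformation fun ε x => x + ε • h x • e :=
  ⟨contDiff_snd.add (contDiff_fst.smul ((hh.comp contDiff_snd).smul contDiff_const)),
    fun x => by simp⟩

lemma velocity_add_smul {n : ℕ} {h : (Fin n → ℝ) → ℝ} (e x : Fin n → ℝ) (i : Fin n) :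
    deriv (fun ε : ℝ => (x + ε • h x • e) i) 0 = h x * e i := by
  have h1 : HasDerivAt (fun ε : ℝ => x i + ε * (h x * e i)) (h x * e i) 0 := by
    simpa using ((hasDerivAt_id (0 : ℝ)).mul_const (h x * e i)).const_add (x i)
  simp [h1.deriv]

/-- With Φ held fixed and the surface moved by h e_σ, the pairs (Y, K) and (τ, K) compute the same
derivative of S. The K-terms agree, so the flux of h (Y - τ)_σ vanishes for every smooth h. -/
theorem conormal_sum_functionalDerivative_sub_eq_zero (hL : IsLagrangian L 𝒰)
    {𝓕 : Set (Set (Fin (m + 1) → ℝ) × ((Fin (m + 1) → ℝ) → Fin f → 𝕜))}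
    {S : BoundaryFunctional 𝕜 (m + 1) f N} (hS : IsPrincipalFunctional L 𝒰 𝓕 S)
    (hΩ : IsOpen Ω) (hΩb : Bornology.IsBounded Ω) (𝒜 : BoundaryAtlas m Ω)
    {Φ : (Fin (m + 1) → ℝ) → Fin f → 𝕜} (hΦ : (Ω, Φ) ∈ 𝓕)
    (hdef : ∀ ψ : ℝ → (Fin (m + 1) → ℝ) → (Fin (m + 1) → ℝ), IsDeformation ψ →
        ∀ᶠ ε in 𝓝 (0 : ℝ), (ψ ε '' Ω, Φ) ∈ 𝓕)
    {Y : (Fin (m + 1) → ℝ) → Fin (m + 1) → Fin (m + 1) → 𝕜}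
    (hY : IsFunctionalDerivative 𝒜 S (realVariations N 𝓕 Ω Φ) Y (momentumK L Φ))
    (k : Fin 𝒜.r) (θ : Fin m → ℝ) (hθ : (𝒜.patch k).point θ ∈ (𝒜.patch k).W)
    (σ : Fin (m + 1)) :
    ∑ l, (𝒜.patch k).conormal θ l • (Y ((𝒜.patch k).point θ) l σ -
      energyMomentum L Φ ((𝒜.patch k).point θ) l σ) = 0 := by
  have hreal : IsRealMovement L 𝒰 Ω Φ := (hS _ hΦ).1
  have hΩD : frontier Ω ⊆ jetDomain 𝒰 Φ := fun x hx => hreal.mem x (frontier_subset_closure hx)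
  have hτ := isFunctionalDerivative_principal hL hS hΩ hΩb 𝒜 hΦ
  have hUc : ContinuousOn (fun x l => Y x l σ - energyMomentum L Φ x l σ) (frontier Ω) :=
    continuousOn_pi.2 fun l =>
      (continuousOn_pi.1 (continuousOn_pi.1 hY.continuousOn_left l) σ).sub
        (continuousOn_pi.1 (continuousOn_pi.1 hτ.continuousOn_left l) σ)
  refine 𝒜.conormal_sum_eq_zero hΩ hUc (fun h hh => ?_) k θ hθ
  set ψ : ℝ → (Fin (m + 1) → ℝ) → (Fin (m + 1) → ℝ) :=
    fun ε x => x + ε • h x • Pi.single σ (1 : ℝ) with hψ_def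
  have hψ : IsDeformation ψ := isDeformation_add_smul hh _
  have hΦs : ContDiff ℝ ∞ (fun p : ℝ × (Fin (m + 1) → ℝ) => (fun _ : ℝ => Φ) p.1 p.2) :=
    hreal.smooth.comp contDiff_snd
  have hadm : (ψ, fun _ x => jet N Φ x) ∈ realVariations N 𝓕 Ω Φ :=
    ⟨hψ, fun _ => Φ, hΦs, rfl, hdef ψ hψ, fun _ _ => rfl⟩
  have heq := (hY.variation _ hadm).unique (hτ.variation _ hadm)
  have hcur := fun x l => variationCurrent_eq (L := L) (Φs := fun _ => Φ) hψ hΦs x l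
  have hvel : ∀ x μ, deriv (fun ε : ℝ => ψ ε x μ) 0 = h x * (Pi.single σ 1 : Fin (m + 1) → ℝ) μ :=
    fun x μ => velocity_add_smul _ x μ
  have hYcur : ∀ x l, (∑ μ, Y x l μ * ((deriv (fun ε : ℝ => ψ ε x μ) 0 : ℝ) : 𝕜)) +
      ∑ k : Fin N, ∑ ν : Fin (k : ℕ) → Fin (m + 1), ∑ B : Fin f,
        momentumK L Φ x l k ν B * deriv (fun ε : ℝ => jet N Φ (ψ ε x) k ν B) 0 =
      variationCurrent L ψ (fun _ => Φ) l x +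
        h x • (Y x l σ - energyMomentum L Φ x l σ) := by
    intro x l
    have hs : ∀ A : Fin (m + 1) → 𝕜, ∑ μ, A μ * ((deriv (fun ε : ℝ => ψ ε x μ) 0 : ℝ) : 𝕜) =
        h x • A σ := by
      intro A
      rw [Finset.sum_eq_single σ]
      · simp [hvel, RCLike.real_smul_eq_coe_mul, mul_comm]
      · intro μ _ hμ
        simp [hvel, hμ]
      · simp
    have h1 := hcur x l
    rw [hs] at h1 ⊢
    rw [← h1, smul_sub]
    ring
  have hVc : ContinuousOn (fun x l => variationCurrent L ψ (fun _ => Φ) l x) (frontier Ω) :=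
    continuousOn_pi.2 fun l =>
      (contDiffOn_variationCurrent hL hψ hΦs hreal.smooth l).continuousOn.mono hΩD
  have hWc : ContinuousOn (fun x l => h x • (Y x l σ - energyMomentum L Φ x l σ)) (frontier Ω) :=
    continuousOn_pi.2 fun l =>
      hh.continuous.continuousOn.smul (continuousOn_pi.1 hUc l)
  simp only [hYcur, hcur] at heq
  -- The flux is additive only for integrable integrands, which is where continuity of Y on the
  -- frontier enters.
  have hsub := 𝒜.flux_sub hΩ (hVc.add hWc) hVc
  simp only [Pi.add_apply, add_sub_cancel_left] at hsub
  rw [hsub]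
  exact sub_eq_zero.2 heq

end Uniqueness

end HamiltonJacobi

end

theorem mainTheorem4 {𝕜 : Type*} [RCLike 𝕜] {m f N : ℕ} (hm : 2 ≤ m + 1) (hN : 1 ≤ N)
    (L : (Fin (m + 1) → ℝ) × HamiltonJacobi.Jet 𝕜 (m + 1) f (N + 1) → 𝕜)
    (𝒰 : Set ((Fin (m + 1) → ℝ) × HamiltonJacobi.Jet 𝕜 (m + 1) f (N + 1)))
    (hL : HamiltonJacobi.IsLagrangian L 𝒰)
    (𝓕 : Set (Set (Fin (m + 1) → ℝ) × ((Fin (m + 1) → ℝ) → Fin f → 𝕜)))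
    (S : HamiltonJacobi.BoundaryFunctional 𝕜 (m + 1) f N)
    (hS : HamiltonJacobi.IsPrincipalFunctional L 𝒰 𝓕 S)
    (Ω : Set (Fin (m + 1) → ℝ)) (hΩ : IsOpen Ω) (hΩb : Bornology.IsBounded Ω)
    (𝒜 : HamiltonJacobi.BoundaryAtlas m Ω)
    (Φ : (Fin (m + 1) → ℝ) → Fin f → 𝕜) (hΦ : (Ω, Φ) ∈ 𝓕) :
    HamiltonJacobi.IsFunctionalDerivative 𝒜 S (HamiltonJacobi.realVariations N 𝓕 Ω Φ)
      (HamiltonJacobi.energyMomentum L Φ) (HamiltonJacobi.momentumK L Φ) ∧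
    ((∀ ψ : ℝ → (Fin (m + 1) → ℝ) → (Fin (m + 1) → ℝ), HamiltonJacobi.IsDeformation ψ →
        ∀ᶠ ε in 𝓝 (0 : ℝ), (ψ ε '' Ω, Φ) ∈ 𝓕) →
      ∀ Y : (Fin (m + 1) → ℝ) → Fin (m + 1) → Fin (m + 1) → 𝕜,
        HamiltonJacobi.IsFunctionalDerivative 𝒜 S (HamiltonJacobi.realVariations N 𝓕 Ω Φ)
          Y (HamiltonJacobi.momentumK L Φ) →
        ∀ (k : Fin 𝒜.r) (θ : Fin m → ℝ), (𝒜.patch k).point θ ∈ (𝒜.patch k).W →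
          ∀ σ : Fin (m + 1), ∑ l, (𝒜.patch k).conormal θ l •
            (Y ((𝒜.patch k).point θ) l σ -
              HamiltonJacobi.energyMomentum L Φ ((𝒜.patch k).point θ) l σ) = 0) :=
  ⟨HamiltonJacobi.isFunctionalDerivative_principal hL hS hΩ hΩb 𝒜 hΦ, fun hdef _ hY k θ hθ σ =>
    HamiltonJacobi.conormal_sum_functionalDerivative_sub_eq_zero hL hS hΩ hΩb 𝒜 hΦ hdef hY k θ hθ σ⟩
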